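/- **Setting.** Let $\Gamma=\bigcup_{\gamma\in\mathcal E}\gamma([0,1])\subset\mathbb R^N$ be a connected network: $\mathcal E$ is a finite collection of regular ($C^1$ with non-vanishing derivative) simple, possibly closed, curves (arcs) parametrized by $[0,1]$; $\mathcal E$ is closed under $\gamma\mapsto-\gamma$, where $-\gamma(s)=\gamma(1-s)$ ($\gamma$ and $-\gamma$ count as distinct arcs); $\gamma((0,1))\cap\gamma'([0,1])=\emptyset$ whenever $\gamma'\neq\pm\gamma$; any two vertices are linked by a finite concatenation of arcs. The set $\mathbf V$ of vertices consists of the points $\mathrm o(\gamma)=\gamma(0)$ and $\mathrm t(\gamma)=\gamma(1)$, $\gamma\in\mathcal E$. No other restriction is put on the geometry of the network. Let $\lambda>0$ and let $H_\gamma:[0,1]\times\mathbb R\to\mathbb R$, $\gamma\in\mathcal E$, be continuous Hamiltonians, coercive in $p$ (i.e. $H_\gamma(s,p)\to+\infty$ as $|p|\to\infty$, uniformly in $s\in[0,1]$), with $H_{-\gamma}(s,p)=H_\gamma(1-s,-p)$ for all $\gamma,s,p$. Let $w:[0,1]\to\mathbb R$ be continuous. It is a subsolution (resp. supersolution) of $\lambda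 w+H_\gamma(s,w')=0$ in $(0,1)$ if $\lambda\varphi(s)+H_\gamma(s,\varphi'(s))\le 0$ (resp. $\ge0$) whenever $s\in(0,1)$ and $\varphi$ is a $C^1$ function with $\varphi(s)=w(s)$ and $w\le\varphi$ (resp. $w\ge\varphi$) near $s$. It satisfies the state constraint boundary condition at $s=1$ if $\lambda\varphi(1)+H_\gamma(1,\varphi'(1))\ge0$ for every $C^1$ function $\varphi$ with $\varphi(1)=w(1)$ and $w\ge\varphi$ in $(1-\delta,1)$ for some $\delta>0$. A function $u:\Gamma\to\mathbb R$ is a *solution* of the discounted problem on $\Gamma$, $(\mathrm{HJ}\Gamma_\lambda)$, if it is continuous, $u\circ\gamma$ is both a subsolution and a supersolution of $\lambda w+H_\gamma(s,w')=0$ in $(0,1)$ for every $\gamma\in\mathcal E$, and for every $x\in\mathbf V$ there is at least one arc $\gamma$ with $\mathrm t(\gamma)=x$ such that $u\circ\gamma$ satisfies the state constraint boundary condition for $H_\gamma$ at $s=1$. A path is a finite non-empty sequence $\xi=(\gamma_1,\dots,\gamma_M)$ of arcs with $\mathrm t(\gamma_j)=\mathrm o(\gamma_{j+1})$; put $\mathrm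 o(\xi)=\mathrm o(\gamma_1)$, $\mathrm t(\xi)=\mathrm t(\gamma_M)$; $\xi$ is a cycle based on $x$ if $\mathrm o(\xi)=\mathrm t(\xi)=x$. For $\alpha\in\mathbb R$ set $$\rho(\alpha,\gamma)=\sup\{w(1)\mid w\in C([0,1])\text{ subsolution of }\lambda w+H_\gamma(s,w')=0\text{ in }(0,1),\ w(0)\le\alpha\},$$ $$\rho(\alpha,\xi)=\rho(\cdots\rho(\rho(\alpha,\gamma_1),\gamma_2)\cdots,\gamma_M).$$ For a cycle $\xi$ let $\beta(\xi)$ be the unique fixed point of $\alpha\mapsto\rho(\alpha,\xi)$, and for $x\in\mathbf V$ set $$f(x)=\inf\{\beta(\xi)\mid\xi\text{ cycle based on }x\},\qquad U(x)=\inf\{\rho(f(\mathrm o(\xi)),\xi)\mid\xi\text{ path with }\mathrm t(\xi)=x\}.$$ **Theorem.** There is one and only one solution $u$ of $(\mathrm{HJ}\Gamma_\lambda)$, and $u(x)=U(x)$ for every $x\in\mathbf V$. Here all quantities in the formula for $U$ are well defined: the set defining $\rho(\alpha,\gamma)$ is non-empty and bounded above, every cycle $\xi$ has exactly one fixed point of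 $\rho(\cdot,\xi)$, and the sets defining $f(x)$ and $U(x)$ are non-empty and bounded below. -/

import Mathlib

open Set

noncomputable section

namespace HJNetwork

/-! ### Viscosity notions for `lam * w + H (s, w') = 0` on the unit interval

A function on `[0,1]` is represented by `w : ℝ → ℝ`, and only its values on `[0,1]` are used. -/

/-- `φ` is a (`C¹`) supertangent to `w` at the interior point `s`. -/
def IsSupertangent (φ w : ℝ → ℝ) (s : ℝ) : Prop :=
  ContDiff ℝ 1 φ ∧ w s = φ s ∧
    ∃ δ > 0, ∀ r ∈ Ioo (s - δ) (s + δ), r ∈ Icc (0 : ℝ) 1 → w r ≤ φ r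

/-- `φ` is a (`C¹`) subtangent to `w` at the interior point `s`. -/
def IsSubtangent (φ w : ℝ → ℝ) (s : ℝ) : Prop :=
  ContDiff ℝ 1 φ ∧ w s = φ s ∧
    ∃ δ > 0, ∀ r ∈ Ioo (s - δ) (s + δ), r ∈ Icc (0 : ℝ) 1 → φ r ≤ w r

/-- `φ` is a (`C¹`) constrained subtangent to `w` at the endpoint `1`. -/
def IsConstrainedSubtangentAtOne (φ w : ℝ → ℝ) : Prop :=
  ContDiff ℝ 1 φ ∧ w 1 = φ 1 ∧
    ∃ δ > 0, ∀ r ∈ Ioo (1 - δ) 1, r ∈ Icc (0 : ℝ) 1 → φ r ≤ w r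

/-- Continuous viscosity subsolution of `lam * w + H (s, w') = 0` in `(0,1)`. -/
def IsArcSubsolution (lam : ℝ) (H : ℝ → ℝ → ℝ) (w : ℝ → ℝ) : Prop :=
  ContinuousOn w (Icc 0 1) ∧
    ∀ s ∈ Ioo (0 : ℝ) 1, ∀ φ : ℝ → ℝ, IsSupertangent φ w s →
      lam * φ s + H s (deriv φ s) ≤ 0

/-- Continuous viscosity supersolution of `lam * w + H (s, w') = 0` in `(0,1)`. -/
def IsArcSupersolution (lam : ℝ) (H : ℝ → ℝ → ℝ) (w : ℝ → ℝ) : Prop :=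
  ContinuousOn w (Icc 0 1) ∧
    ∀ s ∈ Ioo (0 : ℝ) 1, ∀ φ : ℝ → ℝ, IsSubtangent φ w s →
      0 ≤ lam * φ s + H s (deriv φ s)

/-- The state constraint boundary condition at `s = 1`. -/
def StateConstraintAtOne (lam : ℝ) (H : ℝ → ℝ → ℝ) (w : ℝ → ℝ) : Prop :=
  ∀ φ : ℝ → ℝ, IsConstrainedSubtangentAtOne φ w → 0 ≤ lam * φ 1 + H 1 (deriv φ 1)

/-- The Hamiltonian is continuous on `[0,1] × ℝ`. -/
def IsContinuousHamiltonian (H : ℝ → ℝ → ℝ) : Prop :=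
  ContinuousOn (fun q : ℝ × ℝ => H q.1 q.2) (Icc (0 : ℝ) 1 ×ˢ univ)

/-- The Hamiltonian is coercive in the momentum: `H (s, p) → +∞` as `|p| → ∞`, uniformly in `s`. -/
def IsCoerciveHamiltonian (H : ℝ → ℝ → ℝ) : Prop :=
  ∀ M : ℝ, ∃ R : ℝ, ∀ s ∈ Icc (0 : ℝ) 1, ∀ p : ℝ, R ≤ |p| → M ≤ H s p

/-! ### Networks -/

/-- A connected network immersed in `ℝᴺ`. The (directed) edges of the underlying graph are the
elements of `E`, the arc attached to the edge `e` is `arc e`, parametrized by `[0,1]` (values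
outside `[0,1]` play no role), and `rev e` is the edge with the opposite orientation. -/
structure Network (N : ℕ) (E : Type*) where
  arc : E → ℝ → EuclideanSpace ℝ (Fin N)
  rev : E → E
  rev_rev : ∀ e, rev (rev e) = e
  rev_ne : ∀ e, rev e ≠ e
  arc_rev : ∀ e, ∀ s ∈ Icc (0 : ℝ) 1, arc (rev e) s = arc e (1 - s)
  /-- arcs are regular curves -/
  contDiffOn_arc : ∀ e, ContDiffOn ℝ 1 (arc e) (Icc 0 1)
  deriv_arc_ne_zero : ∀ e, ∀ s ∈ Icc (0 : ℝ) 1, derivWithin (arc e) (Icc 0 1) s ≠ 0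
  /-- arcs are simple curves, possibly closed -/
  simple_arc : ∀ e, ∀ s ∈ Icc (0 : ℝ) 1, ∀ t ∈ Icc (0 : ℝ) 1, s < t →
    arc e s = arc e t → s = 0 ∧ t = 1
  /-- the interior of an arc meets no other arc -/
  arc_disjoint : ∀ e e', e' ≠ e → e' ≠ rev e →
    ∀ s ∈ Ioo (0 : ℝ) 1, ∀ t ∈ Icc (0 : ℝ) 1, arc e s ≠ arc e' t
  /-- any two vertices are linked by a finite concatenation of arcs -/
  connected : ∀ e e', Relation.ReflTransGen
    (fun x y => ∃ a, arc a 0 = x ∧ arc a 1 = y) (arc e 0) (arc e' 0)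

namespace Network

variable {N : ℕ} {E : Type*} (G : Network N E)

/-- The initial vertex of an edge. -/
def orig (e : E) : EuclideanSpace ℝ (Fin N) := G.arc e 0

/-- The terminal vertex of an edge. -/
def term (e : E) : EuclideanSpace ℝ (Fin N) := G.arc e 1

/-- The vertices: initial and terminal points of the arcs. -/
def vertices : Set (EuclideanSpace ℝ (Fin N)) := {x | ∃ e, G.orig e = x ∨ G.term e = x}

/-- The network as a subset of `ℝᴺ`. -/
def carrier : Set (EuclideanSpace ℝ (Fin N)) := ⋃ e, G.arc e '' Icc 0 1

/-- The point of parameter `s` on the arc of `e`, as a point of the network. -/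
def point (e : E) (s : Icc (0 : ℝ) 1) : G.carrier :=
  ⟨G.arc e s, mem_iUnion.2 ⟨e, mem_image_of_mem _ s.2⟩⟩

/-- The function `s ↦ u (γ s)` on `[0,1]`, where `γ` is the arc of `e`, extended to `ℝ` by
constants outside `[0,1]`. -/
def pull (u : G.carrier → ℝ) (e : E) : ℝ → ℝ :=
  IccExtend zero_le_one fun s => u (G.point e s)

/-- `G.IsPath x ξ y`: the nonempty list of edges `ξ` is a path (a sequence of concatenated edges)
with initial vertex `x` and terminal vertex `y`. It is a cycle based on `x` if `x = y`. -/
inductive IsPath : EuclideanSpace ℝ (Fin N) → List E → EuclideanSpace ℝ (Fin N) → Prop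
  | single (e : E) : IsPath (G.orig e) [e] (G.term e)
  | cons (e : E) {ξ : List E} {y : EuclideanSpace ℝ (Fin N)} :
      IsPath (G.term e) ξ y → IsPath (G.orig e) (e :: ξ) y

/-! ### The Hamilton-Jacobi problem on the network -/

/-- Subsolutions of the discounted problem on the network. -/
def IsSubsolution (lam : ℝ) (H : E → ℝ → ℝ → ℝ) (u : G.carrier → ℝ) : Prop :=
  Continuous u ∧ ∀ e, IsArcSubsolution lam (H e) (G.pull u e)

/-- Supersolutions of the discounted problem on the network. -/
def IsSupersolution (lam : ℝ) (H : E → ℝ → ℝ → ℝ) (u : G.carrier → ℝ) : Prop :=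
  Continuous u ∧ (∀ e, IsArcSupersolution lam (H e) (G.pull u e)) ∧
    ∀ x ∈ G.vertices, ∃ e, G.term e = x ∧ StateConstraintAtOne lam (H e) (G.pull u e)

/-- Solutions of the discounted problem on the network. -/
def IsSolution (lam : ℝ) (H : E → ℝ → ℝ → ℝ) (u : G.carrier → ℝ) : Prop :=
  G.IsSubsolution lam H u ∧ G.IsSupersolution lam H u

end Network

/-! ### The functional on paths and the representation formula -/

/-- The values at `s = 1` of the subsolutions `w` on the arc with `w 0 ≤ α`. -/
def rhoSet (lam : ℝ) (H : ℝ → ℝ → ℝ) (α : ℝ) : Set ℝ :=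
  {r | ∃ w : ℝ → ℝ, IsArcSubsolution lam H w ∧ w 0 ≤ α ∧ w 1 = r}

/-- `ρ(α, e)`: the value at `s = 1` of the maximal subsolution on the arc of `e` which is at most
`α` at `s = 0`. -/
def rho {E : Type*} (lam : ℝ) (H : E → ℝ → ℝ → ℝ) (α : ℝ) (e : E) : ℝ :=
  sSup (rhoSet lam (H e) α)

/-- `ρ(α, ξ)` for a path `ξ = (e₁, …, e_M)`: the value `ρ(⋯ρ(ρ(α, e₁), e₂)⋯, e_M)`. -/
def rhoPath {E : Type*} (lam : ℝ) (H : E → ℝ → ℝ → ℝ) (α : ℝ) (ξ : List E) : ℝ :=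
  ξ.foldl (rho lam H) α

/-- `β(ξ)`: the fixed point of `α ↦ ρ(α, ξ)`. -/
def beta {E : Type*} (lam : ℝ) (H : E → ℝ → ℝ → ℝ) (ξ : List E) : ℝ :=
  Classical.epsilon fun α => rhoPath lam H α ξ = α

namespace Network

variable {N : ℕ} {E : Type*} (G : Network N E)

/-- The values `β(ξ)` for the cycles `ξ` based on `x`. -/
def fSet (lam : ℝ) (H : E → ℝ → ℝ → ℝ) (x : EuclideanSpace ℝ (Fin N)) : Set ℝ :=
  {r | ∃ ξ, G.IsPath x ξ x ∧ beta lam H ξ = r}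

/-- `f(x)`, the infimum of `β(ξ)` over the cycles `ξ` based on `x`. -/
def f (lam : ℝ) (H : E → ℝ → ℝ → ℝ) (x : EuclideanSpace ℝ (Fin N)) : ℝ :=
  sInf (G.fSet lam H x)

/-- The values `ρ(f(y), ξ)` for the paths `ξ` with initial vertex `y` and terminal vertex `x`. -/
def USet (lam : ℝ) (H : E → ℝ → ℝ → ℝ) (x : EuclideanSpace ℝ (Fin N)) : Set ℝ :=
  {r | ∃ y ξ, G.IsPath y ξ x ∧ rhoPath lam H (G.f lam H y) ξ = r}

/-- `U(x)`, the infimum of `ρ(f(o(ξ)), ξ)` over the paths `ξ` with terminal vertex `x`. -/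
def U (lam : ℝ) (H : E → ℝ → ℝ → ℝ) (x : EuclideanSpace ℝ (Fin N)) : ℝ :=
  sInf (G.USet lam H x)

end Network

end HJNetwork

end

/-!
The problem reduces to a discrete equation on the vertices.

On a single arc, subsolutions are bounded above and, given a lower bound, equi-Lipschitz, by
coercivity. Hence for all `a`, `b` there is a largest subsolution with boundary values at most `a`
at `0` and `b` at `1` (`exists_isMaximalSubsolution`). A bump argument
(`IsArcSubsolution.exists_bump`) shows that it is a supersolution and that it satisfies the state
constraint at `1` when its value there is `ρ(a, e)`. Conversely, comparison holds between
subsolutions and supersolutions ordered at `0` and either ordered at `1` or subject to the state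
constraint there (`IsArcSubsolution.le_of_isArcSupersolution`); no convexity of the Hamiltonian is
used, only the Lipschitz continuity of the subsolution.

The map `ρ(·, e)` is monotone and strictly nonexpansive (`IsDiscountedFamily.rho_sub_lt`), so
`ρ(·, ξ)` has exactly one fixed point `β(ξ)` for each nonempty `ξ`, and `α ≤ ρ(α, ξ)` forces
`α ≤ β(ξ)`.

By comparison the trace `g` of a solution on the vertices satisfies `g(x) = min ρ(g(o(e)), e)` over
the edges `e` ending at `x` (`Network.IsDiscreteSolution`). Following optimal edges backwards from
`x`, finiteness yields a cycle, where `g` equals `β`; so `g = U` (`IsDiscreteSolution.eq_U`), and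
comparison on each arc gives uniqueness. Conversely `U` satisfies the discrete equation
(`isDiscreteSolution_U`). The inequalities along `e` and its reversal guarantee that the largest
subsolution on each arc with boundary values `U` attains these values, and gluing these functions
gives a solution (`exists_isSolution`).
-/

namespace HJNetwork

section Arc

variable {lam : ℝ} {H : ℝ → ℝ → ℝ} {w v W φ ψ : ℝ → ℝ}

/-! ### Hamiltonians on the unit interval -/

/-- Freezing the state variable outside `[0,1]` makes the Hamiltonian continuous on the plane. -/
lemma IsContinuousHamiltonian.continuous_projIcc (hH : IsContinuousHamiltonian H) :
    Continuous fun q : ℝ × ℝ => H (projIcc 0 1 zero_le_one q.1) q.2 := by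
  have h : Continuous fun q : ℝ × ℝ =>
      (((projIcc (0 : ℝ) 1 zero_le_one q.1 : ℝ), q.2) : ℝ × ℝ) := by fun_prop
  exact hH.comp_continuous h fun q => ⟨(projIcc (0 : ℝ) 1 zero_le_one q.1).2, mem_univ _⟩

lemma IsContinuousHamiltonian.uniform (hH : IsContinuousHamiltonian H) (R : ℝ) {η : ℝ}
    (hη : 0 < η) :
    ∃ δ > 0, ∀ s ∈ Icc (0 : ℝ) 1, ∀ t ∈ Icc (0 : ℝ) 1, ∀ p q : ℝ, |p| ≤ R → |q| ≤ R →
      |s - t| < δ → |p - q| < δ → |H s p - H t q| < η := by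
  have hK : IsCompact (Icc (0 : ℝ) 1 ×ˢ Icc (-R) R) := isCompact_Icc.prod isCompact_Icc
  have hu := hK.uniformContinuousOn_of_continuous
    (hH.mono (prod_mono_right (subset_univ _)))
  obtain ⟨δ, hδ, h⟩ := Metric.uniformContinuousOn_iff.1 hu η hη
  refine ⟨δ, hδ, fun s hs t ht p q hp hq hst hpq => ?_⟩
  have := h (s, p) ⟨hs, abs_le.1 hp⟩ (t, q) ⟨ht, abs_le.1 hq⟩
    (by rw [Prod.dist_eq]; exact max_lt hst hpq)
  exact this

lemma IsContinuousHamiltonian.exists_lower_bound (hH : IsContinuousHamiltonian H)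
    (hc : IsCoerciveHamiltonian H) : ∃ K : ℝ, ∀ s ∈ Icc (0 : ℝ) 1, ∀ p : ℝ, -K ≤ H s p := by
  obtain ⟨R, hR⟩ := hc 0
  have hK : IsCompact (Icc (0 : ℝ) 1 ×ˢ Icc (-R) R) := isCompact_Icc.prod isCompact_Icc
  obtain ⟨m, hm⟩ := (hK.image_of_continuousOn
    (hH.mono (prod_mono_right (subset_univ _)))).bddBelow
  refine ⟨max (-m) 0, fun s hs p => ?_⟩
  rcases le_total R |p| with h | h
  · linarith [hR s hs p h, le_max_right (-m) 0]
  · have : m ≤ H s p := hm (mem_image_of_mem (fun q : ℝ × ℝ => H q.1 q.2)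
      (show (s, p) ∈ Icc (0 : ℝ) 1 ×ˢ Icc (-R) R from ⟨hs, abs_le.1 h⟩))
    linarith [le_max_left (-m) 0]

/-! ### Subsolutions on an arc -/

lemma IsArcSubsolution.congr (hw : IsArcSubsolution lam H w) (h : EqOn v w (Icc 0 1)) :
    IsArcSubsolution lam H v := by
  refine ⟨hw.1.congr h, fun s hs φ hφ => hw.2 s hs φ ⟨hφ.1, ?_, ?_⟩⟩
  · rw [← h (Ioo_subset_Icc_self hs), hφ.2.1]
  · obtain ⟨δ, hδ, hle⟩ := hφ.2.2
    exact ⟨δ, hδ, fun r hr hr' => h hr' ▸ hle r hr hr'⟩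

lemma IsArcSupersolution.congr (hw : IsArcSupersolution lam H w) (h : EqOn v w (Icc 0 1)) :
    IsArcSupersolution lam H v := by
  refine ⟨hw.1.congr h, fun s hs φ hφ => hw.2 s hs φ ⟨hφ.1, ?_, ?_⟩⟩
  · rw [← h (Ioo_subset_Icc_self hs), hφ.2.1]
  · obtain ⟨δ, hδ, hle⟩ := hφ.2.2
    exact ⟨δ, hδ, fun r hr hr' => h hr' ▸ hle r hr hr'⟩

lemma StateConstraintAtOne.congr (hw : StateConstraintAtOne lam H w) (h : EqOn v w (Icc 0 1)) :
    StateConstraintAtOne lam H v := by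
  refine fun φ hφ => hw φ ⟨hφ.1, ?_, ?_⟩
  · rw [← h (right_mem_Icc.2 zero_le_one), hφ.2.1]
  · obtain ⟨δ, hδ, hle⟩ := hφ.2.2
    exact ⟨δ, hδ, fun r hr hr' => h hr' ▸ hle r hr hr'⟩

lemma IsArcSubsolution.congr_hamiltonian {H' : ℝ → ℝ → ℝ} (hw : IsArcSubsolution lam H w)
    (h : ∀ s ∈ Icc (0 : ℝ) 1, ∀ p, H' s p = H s p) : IsArcSubsolution lam H' w :=
  ⟨hw.1, fun s hs φ hφ => by
    rw [h s (Ioo_subset_Icc_self hs)]; exact hw.2 s hs φ hφ⟩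

lemma IsArcSubsolution.reflect (hw : IsArcSubsolution lam H w) :
    IsArcSubsolution lam (fun s p => H (1 - s) (-p)) fun s => w (1 - s) := by
  have hc : Continuous fun s : ℝ => 1 - s := by fun_prop
  refine ⟨hw.1.comp hc.continuousOn fun s hs => ⟨by linarith [hs.2], by linarith [hs.1]⟩, ?_⟩
  rintro s hs φ ⟨hφ, h0, δ, hδ, hle⟩
  have := hw.2 (1 - s) ⟨by linarith [hs.2], by linarith [hs.1]⟩ (fun r => φ (1 - r))
    ⟨hφ.comp (contDiff_const.sub contDiff_id), by simpa using h0, δ, hδ, fun r hr hr' => by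
      have := hle (1 - r) ⟨by linarith [hr.2], by linarith [hr.1]⟩
        ⟨by linarith [hr'.2], by linarith [hr'.1]⟩
      simpa using this⟩
  rw [deriv_comp_const_sub] at this
  simpa using this

lemma IsArcSubsolution.sup (hw : IsArcSubsolution lam H w) (hv : IsArcSubsolution lam H v) :
    IsArcSubsolution lam H fun s => max (w s) (v s) := by
  refine ⟨hw.1.sup hv.1, ?_⟩
  rintro s hs φ ⟨hφ, h0, δ, hδ, hle⟩
  rcases le_total (w s) (v s) with h | h
  · refine hv.2 s hs φ ⟨hφ, (max_eq_right h).symm.trans h0, δ, hδ, fun r hr hr' => ?_⟩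
    exact (le_max_right _ _).trans (hle r hr hr')
  · refine hw.2 s hs φ ⟨hφ, (max_eq_left h).symm.trans h0, δ, hδ, fun r hr hr' => ?_⟩
    exact (le_max_left _ _).trans (hle r hr hr')

lemma IsArcSubsolution.sub_const (hlam : 0 < lam) (hw : IsArcSubsolution lam H w) {c : ℝ}
    (hc : 0 ≤ c) : IsArcSubsolution lam H fun s => w s - c := by
  refine ⟨hw.1.sub continuousOn_const, ?_⟩
  rintro s hs φ ⟨hφ, h0, δ, hδ, hle⟩
  have := hw.2 s hs (fun r => φ r + c) ⟨hφ.add contDiff_const, by linarith, δ, hδ,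
    fun r hr hr' => by linarith [hle r hr hr']⟩
  rw [deriv_add_const] at this
  nlinarith [mul_nonneg hlam.le hc]

lemma IsSupertangent.deriv_eq {s : ℝ} (hs : s ∈ Ioo (0 : ℝ) 1) (h : IsSupertangent φ ψ s)
    (hψ : DifferentiableAt ℝ ψ s) : deriv φ s = deriv ψ s := by
  obtain ⟨hφ, h0, δ, hδ, hle⟩ := h
  have hd : DifferentiableAt ℝ φ s := (hφ.differentiable one_ne_zero) s
  have hmin : IsLocalMin (fun r => φ r - ψ r) s := by
    filter_upwards [Ioo_mem_nhds (show s - δ < s by linarith) (show s < s + δ by linarith),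
      Icc_mem_nhds hs.1 hs.2] with r hr hr'
    linarith [hle r hr hr']
  have := hmin.deriv_eq_zero
  rw [deriv_fun_sub hd hψ] at this
  linarith

lemma exists_const_subsolution (hlam : 0 < lam) (hH : IsContinuousHamiltonian H) :
    ∃ m₀ : ℝ, ∀ m ≤ m₀, IsArcSubsolution lam H fun _ => m := by
  have hc : ContinuousOn (fun s : ℝ => H s 0) (Icc 0 1) :=
    ContinuousOn.comp (t := Icc (0 : ℝ) 1 ×ˢ univ) (f := fun s : ℝ => ((s, 0) : ℝ × ℝ)) hH
      (by fun_prop) fun s hs => ⟨hs, mem_univ _⟩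
  obtain ⟨K, hK⟩ := (isCompact_Icc.image_of_continuousOn hc).bddAbove
  refine ⟨-K / lam, fun m hm => ⟨continuousOn_const, fun s hs φ hφ => ?_⟩⟩
  have hd := hφ.deriv_eq hs (differentiableAt_const m)
  rw [deriv_const] at hd
  have h1 : H s 0 ≤ K := hK (mem_image_of_mem _ (Ioo_subset_Icc_self hs))
  rw [hd, ← hφ.2.1]
  rw [le_div_iff₀ hlam] at hm
  linarith

/-- If `w - ψ` is larger at some point of `[a,b]` than at both ends, then its maximum is attained in
the interior, where `ψ` is a supertangent up to a constant. -/
lemma IsArcSubsolution.exists_interior_max (hw : IsArcSubsolution lam H w)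
    (hψ : ContDiff ℝ 1 ψ) {a b c : ℝ} (h0a : 0 ≤ a) (hb1 : b ≤ 1) (hc : c ∈ Icc a b)
    (ha : w a - ψ a < w c - ψ c) (hb : w b - ψ b < w c - ψ c) :
    ∃ r ∈ Ioo a b, w c - ψ c ≤ w r - ψ r ∧ lam * w r + H r (deriv ψ r) ≤ 0 := by
  have hsub : Icc a b ⊆ Icc (0 : ℝ) 1 := Icc_subset_Icc h0a hb1
  obtain ⟨r, hr, hmax⟩ := isCompact_Icc.exists_isMaxOn (nonempty_of_mem hc)
    ((hw.1.mono hsub).sub hψ.continuous.continuousOn)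
  have hmax' : ∀ x ∈ Icc a b, w x - ψ x ≤ w r - ψ r := fun x hx => hmax hx
  have hcr := hmax' c hc
  have har : a < r := lt_of_le_of_ne hr.1 (by rintro rfl; linarith)
  have hrb : r < b := lt_of_le_of_ne hr.2 (by rintro rfl; linarith)
  refine ⟨r, ⟨har, hrb⟩, hcr, ?_⟩
  have := hw.2 r ⟨by linarith, by linarith⟩ (fun x => ψ x + (w r - ψ r))
    ⟨hψ.add contDiff_const, by ring, min (r - a) (b - r), lt_min (by linarith) (by linarith),
      fun x hx _ => by
        have h1 := min_le_left (r - a) (b - r)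
        have h2 := min_le_right (r - a) (b - r)
        linarith [hmax' x ⟨by linarith [hx.1], by linarith [hx.2]⟩]⟩
  rw [deriv_add_const] at this
  simpa using this

lemma exists_upper_bound (hlam : 0 < lam) (hH : IsContinuousHamiltonian H)
    (hc : IsCoerciveHamiltonian H) :
    ∃ C : ℝ, ∀ w, IsArcSubsolution lam H w → ∀ s ∈ Icc (0 : ℝ) 1, w s ≤ C := by
  obtain ⟨K, hK⟩ := hH.exists_lower_bound hc
  refine ⟨K / lam, fun w hw => ?_⟩
  have key : ∀ s ∈ Ioo (0 : ℝ) 1, w s ≤ K / lam := by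
    intro s hs
    by_contra! hlt
    rw [div_lt_iff₀ hlam] at hlt
    -- A steep parabola centred at `s` forces an interior maximum.
    obtain ⟨B, hB⟩ := (isCompact_Icc.image_of_continuousOn hw.1).bddAbove
    have hB' : ∀ x ∈ Icc (0 : ℝ) 1, w x ≤ B := fun x hx => hB (mem_image_of_mem w hx)
    have hBs := hB' s (Ioo_subset_Icc_self hs)
    set A := (B - w s + 1) / (min s (1 - s)) ^ 2 with hA
    have hmin : 0 < min s (1 - s) := lt_min hs.1 (by linarith [hs.2])
    have hAm : A * (min s (1 - s)) ^ 2 = B - w s + 1 := by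
      rw [hA]; field_simp
    have hA0 : 0 < A := by rw [hA]; exact div_pos (by linarith) (by positivity)
    have h0 : B - w s + 1 ≤ A * (0 - s) ^ 2 := by
      rw [← hAm, zero_sub, neg_sq]; gcongr; exact min_le_left _ _
    have h1 : B - w s + 1 ≤ A * (1 - s) ^ 2 := by
      rw [← hAm]; gcongr; exact min_le_right _ _
    obtain ⟨r, hr, hcr, hsub⟩ := hw.exists_interior_max (ψ := fun x => A * (x - s) ^ 2)
      (by fun_prop) le_rfl le_rfl (Ioo_subset_Icc_self hs)
      (by have := hB' 0 (by simp); simp only [sub_self]; nlinarith)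
      (by have := hB' 1 (by simp); simp only [sub_self]; nlinarith)
    have h2 := hK r (Ioo_subset_Icc_self hr) (deriv (fun x => A * (x - s) ^ 2) r)
    have h3 : w s ≤ w r := by
      have : 0 ≤ A * (r - s) ^ 2 := by positivity
      simp only [sub_self] at hcr
      nlinarith
    nlinarith [mul_le_mul_of_nonneg_left h3 hlam.le]
  have hcl : closure (Ioo (0 : ℝ) 1) = Icc 0 1 := closure_Ioo zero_ne_one
  intro s hs
  rw [← hcl] at hs
  exact le_on_closure key (by rw [hcl]; exact hw.1) continuousOn_const hs

/-- Increments of a subsolution are controlled as soon as momenta of size larger than `R` violate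
the equation. The test function is a line of slope `R` plus an exponential, which keeps the maximum
away from `1` without decreasing the slope. -/
lemma IsArcSubsolution.sub_le_of_momentum_bound (hw : IsArcSubsolution lam H w) {R : ℝ}
    (hR : ∀ s ∈ Icc (0 : ℝ) 1, ∀ p, lam * w s + H s p ≤ 0 → |p| ≤ R) {s t : ℝ}
    (hs : 0 ≤ s) (hst : s ≤ t) (ht : t ≤ 1) : w t - w s ≤ R * (t - s) := by
  have key : ∀ t ∈ Ico s 1, w t ≤ w s + R * (t - s) := by
    intro t ht
    by_contra! hlt
    obtain ⟨η, hη, hlt⟩ : ∃ η > 0, w s + R * (t - s) + η < w t :=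
      ⟨(w t - (w s + R * (t - s))) / 2, by linarith, by linarith⟩
    have h1t : 0 < 1 - t := by linarith [ht.2]
    set Y := (|w 1 - R * 1 - (w t - R * t - η)| + 1) / η with hY
    have hY0 : 0 < Y := by positivity
    have hYη : η * Y = |w 1 - R * 1 - (w t - R * t - η)| + 1 := by rw [hY]; field_simp
    set B := Y / (1 - t) with hB
    have hB0 : 0 < B := div_pos hY0 h1t
    have hBt : B * (1 - t) = Y := by rw [hB]; field_simp
    have hexp : Y ≤ Real.exp (B * (1 - t)) := by
      rw [hBt]; linarith [Real.add_one_le_exp Y]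
    obtain ⟨r, hr, -, hsub⟩ := hw.exists_interior_max
      (ψ := fun x => R * x + η * Real.exp (B * (x - t))) (by fun_prop) hs le_rfl
      ⟨ht.1, ht.2.le⟩
      (by
        have := mul_pos hη (Real.exp_pos (B * (s - t)))
        simp only [sub_self, mul_zero, Real.exp_zero]
        nlinarith)
      (by
        have := mul_le_mul_of_nonneg_left hexp hη.le
        have := le_abs_self (w 1 - R * 1 - (w t - R * t - η))
        simp only [sub_self, mul_zero, Real.exp_zero]
        linarith)
    have hd : HasDerivAt (fun x => R * x + η * Real.exp (B * (x - t)))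
        (R * 1 + η * (Real.exp (B * (r - t)) * (B * 1))) r :=
      ((hasDerivAt_id r).const_mul R).add
        ((((hasDerivAt_id r).sub_const t).const_mul B).exp.const_mul η)
    rw [hd.deriv] at hsub
    have h1 := hR r ⟨by linarith [hr.1], hr.2.le⟩ _ hsub
    have h2 : 0 < η * (Real.exp (B * (r - t)) * (B * 1)) := by positivity
    linarith [le_abs_self (R * 1 + η * (Real.exp (B * (r - t)) * (B * 1)))]
  rcases hst.eq_or_lt with rfl | hlt
  · simp
  have hs1 : s < 1 := hlt.trans_le ht
  have hcl : closure (Ico s 1) = Icc s 1 := closure_Ico hs1.ne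
  have := le_on_closure key
    (by rw [hcl]; exact hw.1.mono (Icc_subset_Icc hs le_rfl)) (by fun_prop)
    (show t ∈ closure (Ico s 1) by rw [hcl]; exact ⟨hst, ht⟩)
  linarith

/-- Subsolutions with a common lower bound are equi-Lipschitz. -/
lemma exists_lipschitz_bound (hlam : 0 < lam) (hc : IsCoerciveHamiltonian H) (m : ℝ) :
    ∃ R > 0, ∀ w, IsArcSubsolution lam H w → (∀ s ∈ Icc (0 : ℝ) 1, m ≤ w s) →
      (∀ s ∈ Icc (0 : ℝ) 1, ∀ p, lam * w s + H s p ≤ 0 → |p| ≤ R) ∧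
      ∀ s ∈ Icc (0 : ℝ) 1, ∀ t ∈ Icc (0 : ℝ) 1, |w s - w t| ≤ R * |s - t| := by
  obtain ⟨R, hR⟩ := hc (-(lam * m) + 1)
  refine ⟨max R 1, by positivity, fun w hw hm => ?_⟩
  have hmom : ∀ s ∈ Icc (0 : ℝ) 1, ∀ p, lam * w s + H s p ≤ 0 → |p| ≤ max R 1 := by
    intro s hs p hp
    by_contra! hlt
    have h1 := hR s hs p ((le_max_left _ _).trans hlt.le)
    have h2 := mul_le_mul_of_nonneg_left (hm s hs) hlam.le
    linarith
  refine ⟨hmom, ?_⟩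
  have key : ∀ s ∈ Icc (0 : ℝ) 1, ∀ t ∈ Icc (0 : ℝ) 1, s ≤ t →
      |w s - w t| ≤ max R 1 * |s - t| := by
    intro s hs t ht hst
    have h1 := hw.sub_le_of_momentum_bound hmom hs.1 hst ht.2
    have h2 := hw.reflect.sub_le_of_momentum_bound (R := max R 1) (s := 1 - t) (t := 1 - s)
      (fun r hr p hp => by
        rw [← abs_neg]
        exact hmom (1 - r) ⟨by linarith [hr.2], by linarith [hr.1]⟩ _ hp)
      (by linarith [ht.2]) (by linarith) (by linarith [hs.1])
    simp only [sub_sub_cancel] at h2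
    rw [abs_sub_comm s t, abs_of_nonneg (sub_nonneg.2 hst), abs_le]
    constructor <;> linarith
  intro s hs t ht
  rcases le_total s t with h | h
  · exact key s hs t ht h
  · rw [abs_sub_comm, abs_sub_comm s]; exact key t ht s hs h

lemma IsArcSubsolution.exists_lipschitz (hlam : 0 < lam) (hc : IsCoerciveHamiltonian H)
    (hw : IsArcSubsolution lam H w) :
    ∃ R > 0, (∀ s ∈ Icc (0 : ℝ) 1, ∀ p, lam * w s + H s p ≤ 0 → |p| ≤ R) ∧
      ∀ s ∈ Icc (0 : ℝ) 1, ∀ t ∈ Icc (0 : ℝ) 1, |w s - w t| ≤ R * |s - t| := by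
  obtain ⟨m, hm⟩ := (isCompact_Icc.image_of_continuousOn hw.1).bddBelow
  obtain ⟨R, hR, h⟩ := exists_lipschitz_bound (H := H) hlam hc m
  exact ⟨R, hR, h w hw fun s hs => hm (mem_image_of_mem w hs)⟩


/-! ### Perron's method -/

/-- A test function from below at which the supersolution inequality fails can be lifted slightly
to enlarge the subsolution near the contact point `s`, which may be the endpoint `1`. -/
lemma IsArcSubsolution.exists_bump (hH : IsContinuousHamiltonian H)
    (hW : IsArcSubsolution lam H W) {s : ℝ} (hs : s ∈ Ioc (0 : ℝ) 1) (hφ : ContDiff ℝ 1 φ)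
    (h0 : W s = φ s) {δ : ℝ} (hδ : 0 < δ)
    (hle : ∀ r ∈ Ioo (s - δ) (s + δ), r ∈ Icc (0 : ℝ) 1 → φ r ≤ W r)
    (hneg : lam * φ s + H s (deriv φ s) < 0) {ε : ℝ} (hε : 0 < ε) :
    ∃ w, IsArcSubsolution lam H w ∧ W s < w s ∧
      ∀ r ∈ Icc (0 : ℝ) 1, ε ≤ |r - s| → w r = W r := by
  have hs' : s ∈ Icc (0 : ℝ) 1 := ⟨hs.1.le, hs.2⟩
  have hdφ : Continuous (deriv φ) := hφ.continuous_deriv le_rfl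
  have hφc : Continuous φ := hφ.continuous
  -- The inequality persists for nearby points, values and slopes.
  obtain ⟨η, hη, hstrict⟩ : ∃ η > 0, ∀ r k q : ℝ, r ∈ Icc (0 : ℝ) 1 → |r - s| < η → |k| < η →
      |q| < η → lam * (φ r + k) + H r (deriv φ r + q) < 0 := by
    have hF : Continuous fun x : ℝ × ℝ × ℝ => lam * (φ x.1 + x.2.1) +
        H (projIcc 0 1 zero_le_one x.1) (deriv φ x.1 + x.2.2) := by
      have := hH.continuous_projIcc.comp
        (show Continuous fun x : ℝ × ℝ × ℝ => ((x.1, deriv φ x.1 + x.2.2) : ℝ × ℝ) by fun_prop)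
      exact (by fun_prop : Continuous fun x : ℝ × ℝ × ℝ => lam * (φ x.1 + x.2.1)).add this
    have hev := hF.continuousAt.eventually_lt (x₀ := (s, 0, 0)) continuousAt_const
      (show _ < (0 : ℝ) by simpa [projIcc_of_mem zero_le_one hs'] using hneg)
    obtain ⟨η, hη, h⟩ := Metric.eventually_nhds_iff.1 hev
    refine ⟨η, hη, fun r k q hr h1 h2 h3 => ?_⟩
    have := h (y := (r, k, q)) (by
      rw [Prod.dist_eq, Prod.dist_eq]
      simp only [Real.dist_eq, sub_zero]
      exact max_lt h1 (max_lt h2 h3))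
    simpa [projIcc_of_mem zero_le_one hr] using this
  obtain ⟨B, hB⟩ := (isCompact_Icc.image_of_continuousOn
    (hφc.continuousOn.sub hW.1 : ContinuousOn (fun r => φ r - W r) (Icc 0 1))).bddAbove
  have hB' : ∀ r ∈ Icc (0 : ℝ) 1, φ r - W r ≤ B := fun r hr =>
    hB (mem_image_of_mem (fun r => φ r - W r) hr)
  have hB0 : 0 ≤ B := by have := hB' s hs'; rw [h0] at this; linarith
  set A := (B + 1) / δ ^ 2 with hA
  have hA0 : 0 < A := by positivity
  have hAδ : A * δ ^ 2 = B + 1 := by rw [hA]; field_simp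
  have hlim : ∀ g : ℝ → ℝ, Continuous g → g 0 = 0 → ∀ c > 0,
      ∀ᶠ τ in nhdsWithin (0 : ℝ) (Ioi 0), g τ < c := fun g hg hg0 c hc =>
    (hg.continuousAt.eventually_lt continuousAt_const (by rwa [hg0])).filter_mono
      nhdsWithin_le_nhds
  obtain ⟨τ, ⟨⟨⟨⟨⟨hτη, hτε⟩, hτA⟩, hτA2⟩, hτ1⟩, hτ0⟩⟩ :=
    ((((((hlim id continuous_id rfl η hη).and (hlim id continuous_id rfl ε hε)).and
      (hlim (fun τ => 2 * (A * τ)) (by fun_prop) (by simp) η hη)).and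
      (hlim (fun τ => A * τ ^ 2) (by fun_prop) (by simp) η hη)).and
      (hlim (fun τ => A * τ ^ 2) (by fun_prop) (by simp) 1 one_pos)).and
      self_mem_nhdsWithin).exists
  simp only [id] at hτη hτε
  have hτ0 : 0 < τ := hτ0
  set g : ℝ → ℝ := fun r => φ r + (A * τ ^ 2 - A * (r - s) ^ 2) with hg
  have hgd : ∀ r, HasDerivAt g (deriv φ r + -(2 * (A * (r - s)))) r := by
    intro r
    have h1 := ((hφ.differentiable one_ne_zero) r).hasDerivAt
    have h2 := ((((hasDerivAt_id r).sub_const s).pow 2).const_mul A).const_sub (A * τ ^ 2)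
    have := h1.add h2
    refine HasDerivAt.congr_deriv this ?_
    simp only [id]; ring
  have hgc : Continuous g := by fun_prop
  -- The lifted test function exceeds `W` only within distance `τ` of `s`.
  have hnear : ∀ r ∈ Icc (0 : ℝ) 1, W r < g r → |r - s| < τ := by
    intro r hr hlt
    by_contra! hτr
    have hsq : A * τ ^ 2 ≤ A * (r - s) ^ 2 := by
      rw [← sq_abs (r - s)]; gcongr
    rcases lt_or_ge |r - s| δ with h | h
    · have := hle r ⟨by linarith [(abs_lt.1 h).1], by linarith [(abs_lt.1 h).2]⟩ hr
      simp only [hg] at hlt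
      linarith
    · have : A * δ ^ 2 ≤ A * (r - s) ^ 2 := by
        rw [← sq_abs (r - s)]; gcongr
      have := hB' r hr
      simp only [hg] at hlt
      linarith
  refine ⟨fun r => max (W r) (g r), ⟨hW.1.sup hgc.continuousOn, ?_⟩, ?_,
    fun r hr hεr => ?_⟩
  · intro r hr χ hχ
    have hr' := Ioo_subset_Icc_self hr
    rcases le_or_gt (g r) (W r) with h | h
    · obtain ⟨hχ1, hχ0, δ', hδ', hχle⟩ := hχ
      exact hW.2 r hr χ ⟨hχ1, (max_eq_left h).symm.trans hχ0, δ', hδ', fun x hx hx' =>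
        (le_max_left _ _).trans (hχle x hx hx')⟩
    · have hχg : IsSupertangent χ g r := by
        obtain ⟨hχ1, hχ0, δ', hδ', hχle⟩ := hχ
        exact ⟨hχ1, (max_eq_right h.le).symm.trans hχ0, δ', hδ', fun x hx hx' =>
          (le_max_right _ _).trans (hχle x hx hx')⟩
      have hrs := hnear r hr' h
      rw [hχg.deriv_eq hr (hgd r).differentiableAt, (hgd r).deriv, ← hχg.2.1]
      have hsq : A * (r - s) ^ 2 ≤ A * τ ^ 2 := by
        rw [← sq_abs (r - s)]; gcongr
      have hsq0 : 0 ≤ A * (r - s) ^ 2 := by positivity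
      refine (hstrict r _ _ hr' (hrs.trans hτη) ?_ ?_).le
      · rw [abs_of_nonneg (by linarith)]; linarith
      · rw [abs_neg, abs_mul, abs_mul, abs_of_pos hA0, abs_two]
        refine lt_of_le_of_lt ?_ hτA
        gcongr
  · refine lt_max_of_lt_right ?_
    simp only [hg, sub_self, h0]
    have : 0 < A * τ ^ 2 := by positivity
    linarith
  · refine max_eq_left ?_
    by_contra! h
    linarith [hnear r hr h]

/-- `W` is the largest subsolution with boundary values at most `a` at `0` and `b` at `1`. -/
def IsMaximalSubsolution (lam : ℝ) (H : ℝ → ℝ → ℝ) (a b : ℝ) (W : ℝ → ℝ) : Prop :=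
  IsArcSubsolution lam H W ∧ W 0 ≤ a ∧ W 1 ≤ b ∧
    ∀ w, IsArcSubsolution lam H w → w 0 ≤ a → w 1 ≤ b → ∀ s ∈ Icc (0 : ℝ) 1, w s ≤ W s

lemma exists_isMaximalSubsolution (hlam : 0 < lam) (hH : IsContinuousHamiltonian H)
    (hc : IsCoerciveHamiltonian H) (a b : ℝ) : ∃ W, IsMaximalSubsolution lam H a b W := by
  obtain ⟨C, hC⟩ := exists_upper_bound hlam hH hc
  obtain ⟨m₀, hm₀⟩ := exists_const_subsolution hlam hH
  set m := min m₀ (min a b) with hm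
  have hma : m ≤ a := (min_le_right _ _).trans (min_le_left _ _)
  have hmb : m ≤ b := (min_le_right _ _).trans (min_le_right _ _)
  have hmsub : IsArcSubsolution lam H fun _ => m := hm₀ m (min_le_left _ _)
  obtain ⟨R, hR0, hR⟩ := exists_lipschitz_bound (H := H) hlam hc m
  -- It suffices to take the supremum over members of the family bounded below by `m`, as these are
  -- equi-Lipschitz.
  set F : Set (ℝ → ℝ) := {w | IsArcSubsolution lam H w ∧ w 0 ≤ a ∧ w 1 ≤ b ∧ ∀ s, m ≤ w s}
    with hF
  have hne : ∀ s : ℝ, ((fun w : ℝ → ℝ => w s) '' F).Nonempty := fun s =>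
    ⟨m, fun _ => m, ⟨hmsub, hma, hmb, fun _ => le_rfl⟩, rfl⟩
  have hbdd : ∀ s ∈ Icc (0 : ℝ) 1, BddAbove ((fun w : ℝ → ℝ => w s) '' F) := by
    rintro s hs
    refine ⟨C, ?_⟩
    rintro _ ⟨w, hw, rfl⟩
    exact hC w hw.1 s hs
  set W : ℝ → ℝ := fun s => sSup ((fun w : ℝ → ℝ => w s) '' F) with hWdef
  have hle : ∀ w ∈ F, ∀ s ∈ Icc (0 : ℝ) 1, w s ≤ W s := fun w hw s hs =>
    le_csSup (hbdd s hs) (mem_image_of_mem _ hw)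
  have hlip : ∀ s ∈ Icc (0 : ℝ) 1, ∀ t ∈ Icc (0 : ℝ) 1, W s ≤ W t + R * |s - t| := by
    intro s hs t ht
    refine csSup_le (hne s) ?_
    rintro _ ⟨w, hw, rfl⟩
    have h1 := (abs_le.1 ((hR w hw.1 fun s _ => hw.2.2.2 s).2 s hs t ht)).2
    have h2 := hle w hw t ht
    simp only
    linarith
  have hcont : ContinuousOn W (Icc 0 1) := by
    refine (LipschitzOnWith.of_le_add_mul' R ?_).continuousOn
    intro s hs t ht
    rw [Real.dist_eq]
    exact hlip s hs t ht
  refine ⟨W, ⟨hcont, ?_⟩, ?_, ?_, ?_⟩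
  · rintro s hs φ ⟨hφ, h0, δ, hδ, hφle⟩
    have hs' := Ioo_subset_Icc_self hs
    by_contra! hpos
    -- The strict inequality persists near `s`, where some member of the family has a contact point.
    have hdφ : Continuous (deriv φ) := hφ.continuous_deriv le_rfl
    have hφc : Continuous φ := hφ.continuous
    obtain ⟨η, hη, hstrict⟩ : ∃ η > 0, ∀ r k : ℝ, r ∈ Icc (0 : ℝ) 1 → |r - s| < η → |k| < η →
        0 < lam * (φ r + k) + H r (deriv φ r + 2 * (r - s)) := by
      have hG : Continuous fun x : ℝ × ℝ => lam * (φ x.1 + x.2) +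
          H (projIcc 0 1 zero_le_one x.1) (deriv φ x.1 + 2 * (x.1 - s)) := by
        have := hH.continuous_projIcc.comp (show Continuous fun x : ℝ × ℝ =>
          ((x.1, deriv φ x.1 + 2 * (x.1 - s)) : ℝ × ℝ) by fun_prop)
        exact (by fun_prop : Continuous fun x : ℝ × ℝ => lam * (φ x.1 + x.2)).add this
      have hev := continuousAt_const.eventually_lt (hG.continuousAt (x := (s, 0)))
        (show (0 : ℝ) < _ by simpa [projIcc_of_mem zero_le_one hs'] using hpos)
      obtain ⟨η, hη, h⟩ := Metric.eventually_nhds_iff.1 hev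
      refine ⟨η, hη, fun r k hr h1 h2 => ?_⟩
      have := h (y := (r, k)) (by
        rw [Prod.dist_eq]
        simp only [Real.dist_eq, sub_zero]
        exact max_lt h1 h2)
      simpa [projIcc_of_mem zero_le_one hr] using this
    obtain ⟨τ, hτ0, hτ⟩ : ∃ τ > 0, τ < δ ∧ τ < η ∧ τ ≤ s ∧ τ ≤ 1 - s :=
      ⟨min (min (δ / 2) (η / 2)) (min s (1 - s)),
        lt_min (lt_min (by linarith) (by linarith)) (lt_min hs.1 (by linarith [hs.2])),
        by linarith [min_le_left (min (δ / 2) (η / 2)) (min s (1 - s)),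
          min_le_left (δ / 2) (η / 2)],
        by linarith [min_le_left (min (δ / 2) (η / 2)) (min s (1 - s)),
          min_le_right (δ / 2) (η / 2)],
        (min_le_right _ _).trans (min_le_left _ _), (min_le_right _ _).trans (min_le_right _ _)⟩
    obtain ⟨hτδ, hτη, hτs, hτs'⟩ := hτ
    have hκ : 0 < min η (τ ^ 2) := lt_min hη (by positivity)
    obtain ⟨_, ⟨w, hw, rfl⟩, hws⟩ := exists_lt_of_lt_csSup (hne s)
      (show W s - min η (τ ^ 2) < W s by linarith)
    have hκ1 := min_le_left η (τ ^ 2)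
    have hκ2 := min_le_right η (τ ^ 2)
    have hwφ : ∀ r ∈ Icc (s - τ) (s + τ), w r ≤ φ r := fun r hr =>
      (hle w hw r ⟨by linarith [hr.1], by linarith [hr.2]⟩).trans
        (hφle r ⟨by linarith [hr.1], by linarith [hr.2]⟩
          ⟨by linarith [hr.1], by linarith [hr.2]⟩)
    obtain ⟨r, hr, hcr, hsub⟩ := hw.1.exists_interior_max (ψ := fun x => φ x + (x - s) ^ 2)
      (a := s - τ) (b := s + τ) (c := s) (hφ.add (by fun_prop)) (by linarith) (by linarith)
      ⟨by linarith, by linarith⟩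
      (by
        have := hwφ (s - τ) ⟨le_rfl, by linarith⟩
        have e1 : (s - τ - s) ^ 2 = τ ^ 2 := by ring
        have e2 : (s - s) ^ 2 = 0 := by ring
        simp only at hws ⊢
        rw [e1, e2]
        linarith)
      (by
        have := hwφ (s + τ) ⟨by linarith, le_rfl⟩
        have e1 : (s + τ - s) ^ 2 = τ ^ 2 := by ring
        have e2 : (s - s) ^ 2 = 0 := by ring
        simp only at hws ⊢
        rw [e1, e2]
        linarith)
    have hd : HasDerivAt (fun x => φ x + (x - s) ^ 2) (deriv φ r + 2 * (r - s)) r := by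
      have := ((hφ.differentiable one_ne_zero) r).hasDerivAt.add
        (((hasDerivAt_id r).sub_const s).pow 2)
      refine HasDerivAt.congr_deriv this ?_
      simp only [id]; ring
    rw [hd.deriv] at hsub
    have h1 := hwφ r (Ioo_subset_Icc_self hr)
    have h2 : |w r - φ r| < η := by
      have e2 : (s - s) ^ 2 = 0 := by ring
      have := sq_nonneg (r - s)
      simp only [e2] at hcr
      simp only at hws
      rw [abs_lt]
      constructor <;> linarith
    have := hstrict r (w r - φ r) ⟨by linarith [hr.1], by linarith [hr.2]⟩
      (by rw [abs_lt]; constructor <;> linarith [hr.1, hr.2]) h2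
    rw [add_sub_cancel] at this
    linarith
  · refine csSup_le (hne 0) ?_
    rintro _ ⟨w, hw, rfl⟩
    exact hw.2.1
  · refine csSup_le (hne 1) ?_
    rintro _ ⟨w, hw, rfl⟩
    exact hw.2.2.1
  · intro w hw h0 h1 s hs
    refine (le_max_left (w s) m).trans (hle (fun s => max (w s) m)
      ⟨hw.sup hmsub, max_le h0 hma, max_le h1 hmb, fun _ => le_max_right _ _⟩ s hs)

lemma IsMaximalSubsolution.isArcSupersolution {a b : ℝ} (hH : IsContinuousHamiltonian H)
    (hW : IsMaximalSubsolution lam H a b W) : IsArcSupersolution lam H W := by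
  refine ⟨hW.1.1, ?_⟩
  rintro s hs φ ⟨hφ, h0, δ, hδ, hle⟩
  by_contra! hneg
  obtain ⟨w, hw, hlt, heq⟩ := hW.1.exists_bump hH ⟨hs.1, hs.2.le⟩ hφ h0 hδ hle hneg
    (lt_min hs.1 (sub_pos.2 hs.2))
  refine hlt.not_ge (hW.2.2.2 w hw ?_ ?_ s (Ioo_subset_Icc_self hs))
  · rw [heq 0 (by simp) (by rw [zero_sub, abs_neg, abs_of_pos hs.1]; exact min_le_left _ _)]
    exact hW.2.1
  · rw [heq 1 (by simp) (by
      rw [abs_of_pos (sub_pos.2 hs.2)]; exact min_le_right _ _)]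
    exact hW.2.2.1

/-- If no subsolution bounded by `a` at `0` exceeds `W` at `1`, then the bound `b` plays no role and
the bump at the endpoint `1` is forbidden. -/
lemma IsMaximalSubsolution.stateConstraintAtOne {a b : ℝ} (hH : IsContinuousHamiltonian H)
    (hW : IsMaximalSubsolution lam H a b W)
    (hub : ∀ w, IsArcSubsolution lam H w → w 0 ≤ a → w 1 ≤ W 1) :
    StateConstraintAtOne lam H W := by
  rintro φ ⟨hφ, h0, δ, hδ, hle⟩
  by_contra! hneg
  obtain ⟨w, hw, hlt, heq⟩ := hW.1.exists_bump hH (s := 1) ⟨one_pos, le_rfl⟩ hφ h0 hδ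
    (fun r hr hr' => by
      rcases hr'.2.lt_or_eq with h | rfl
      · exact hle r ⟨hr.1, h⟩ hr'
      · exact h0.ge) hneg one_pos
  refine hlt.not_ge (hub w hw ?_)
  rw [heq 0 (by simp) (by simp)]
  exact hW.2.1

lemma IsMaximalSubsolution.eqOn {a b : ℝ} (hW : IsMaximalSubsolution lam H a b W)
    (hw : IsMaximalSubsolution lam H a b w) : EqOn W w (Icc 0 1) := fun s hs =>
  le_antisymm (hw.2.2.2 W hW.1 hW.2.1 hW.2.2.1 s hs) (hW.2.2.2 w hw.1 hw.2.1 hw.2.2.1 s hs)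

/-- The boundary values are attained if each of them can be attained separately: lower the two
corresponding subsolutions by constants and take their maximum. -/
lemma IsMaximalSubsolution.boundary_eq {a b : ℝ} (hlam : 0 < lam)
    (hW : IsMaximalSubsolution lam H a b W) (hw : IsArcSubsolution lam H w) (hw0 : w 0 ≤ a)
    (hw1 : b ≤ w 1) (hv : IsArcSubsolution lam H v) (hv0 : a ≤ v 0) (hv1 : v 1 ≤ b) :
    W 0 = a ∧ W 1 = b := by
  have hmax := hW.2.2.2 _ ((hw.sub_const hlam (sub_nonneg.2 hw1)).sup
    (hv.sub_const hlam (sub_nonneg.2 hv0))) (max_le (by linarith) (by linarith))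
    (max_le (by linarith) (by linarith))
  constructor
  · refine le_antisymm hW.2.1 (le_trans ?_ (hmax 0 (by simp)))
    exact le_max_of_le_right (by linarith)
  · refine le_antisymm hW.2.2.1 (le_trans ?_ (hmax 1 (by simp)))
    exact le_max_of_le_left (by linarith)

/-! ### Comparison on an arc -/

/-- Comparison between a subsolution and a supersolution which are ordered at `0` and, unless the
supersolution satisfies the state constraint there, at `1`. Variables are doubled with a penalty
vanishing at `s = t - h`, so that the subsolution is tested at an interior point even when the
supersolution is tested at `1`. -/
theorem IsArcSubsolution.le_of_isArcSupersolution (hlam : 0 < lam)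
    (hH : IsContinuousHamiltonian H) (hc : IsCoerciveHamiltonian H)
    (hw : IsArcSubsolution lam H w) (hv : IsArcSupersolution lam H v) (h0 : w 0 ≤ v 0)
    (h1 : w 1 ≤ v 1 ∨ StateConstraintAtOne lam H v) :
    ∀ s ∈ Icc (0 : ℝ) 1, w s ≤ v s := by
  obtain ⟨L, hL, -, hwL⟩ := hw.exists_lipschitz hlam hc
  obtain ⟨t₀, ht₀, hmax⟩ := isCompact_Icc.exists_isMaxOn (nonempty_Icc.2 zero_le_one)
    (hw.1.sub hv.1)
  have hmax' : ∀ x ∈ Icc (0 : ℝ) 1, w x - v x ≤ w t₀ - v t₀ := fun x hx => hmax hx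
  by_contra! hex
  obtain ⟨s₁, hs₁, hlt₁⟩ := hex
  set M := w t₀ - v t₀ with hM
  have hM0 : 0 < M := by linarith [hmax' s₁ hs₁]
  have ht₀0 : 0 < t₀ := lt_of_le_of_ne ht₀.1 (by rintro rfl; linarith)
  obtain ⟨δ₁, hδ₁, hvmod⟩ := Metric.uniformContinuousOn_iff.1
    (isCompact_Icc.uniformContinuousOn_of_continuous hv.1) (M / 4) (by linarith)
  obtain ⟨δ₂, hδ₂, hHmod⟩ := hH.uniform (8 * L) (η := lam * (M / 2)) (by positivity)
  obtain ⟨h, hh0, hht, hhL, hhδ₁, hhδ₂⟩ : ∃ h > 0, h < t₀ ∧ L * h < M / 4 ∧ 2 * h < δ₁ ∧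
      2 * h < δ₂ := by
    refine ⟨min (min (t₀ / 2) (M / (8 * L))) (min (δ₁ / 4) (δ₂ / 4)), ?_, ?_, ?_, ?_, ?_⟩
    · have : 0 < M / (8 * L) := by positivity
      exact lt_min (lt_min (by linarith) this) (lt_min (by linarith) (by linarith))
    · refine ((min_le_left _ _).trans (min_le_left _ _)).trans_lt (by linarith)
    · calc _ ≤ L * (M / (8 * L)) := by
            gcongr; exact (min_le_left _ _).trans (min_le_right _ _)
        _ = M / 8 := by field_simp
        _ < M / 4 := by linarith
    · linarith [((min_le_right (min (t₀ / 2) (M / (8 * L))) (min (δ₁ / 4) (δ₂ / 4)))).trans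
        (min_le_left _ _)]
    · linarith [((min_le_right (min (t₀ / 2) (M / (8 * L))) (min (δ₁ / 4) (δ₂ / 4)))).trans
        (min_le_right _ _)]
  set n := 4 * L / h with hn
  have hn0 : 0 < n := by positivity
  have hnh : n * h = 4 * L := by rw [hn]; field_simp
  have hΦc : ContinuousOn (fun q : ℝ × ℝ => w q.1 - v q.2 - n * (q.1 - q.2 + h) ^ 2)
      (Icc (0 : ℝ) 1 ×ˢ Icc (0 : ℝ) 1) :=
    ((hw.1.comp continuousOn_fst fun q hq => hq.1).sub
      (hv.1.comp continuousOn_snd fun q hq => hq.2)).sub (by fun_prop)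
  obtain ⟨⟨s, t⟩, ⟨hs, ht⟩, hΦ⟩ := (isCompact_Icc.prod isCompact_Icc).exists_isMaxOn
    ⟨(0, 0), by simp⟩ hΦc
  have hΦ' : ∀ x ∈ Icc (0 : ℝ) 1, ∀ y ∈ Icc (0 : ℝ) 1,
      w x - v y - n * (x - y + h) ^ 2 ≤ w s - v t - n * (s - t + h) ^ 2 := fun x hx y hy =>
    hΦ (show (x, y) ∈ Icc (0 : ℝ) 1 ×ˢ Icc (0 : ℝ) 1 from ⟨hx, hy⟩)
  simp only at hs ht
  set d := s - t + h with hd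
  -- lower bound for the maximum, from the pair `(t₀ - h, t₀)`
  have hlow : M - L * h ≤ w s - v t - n * d ^ 2 := by
    have e1 := hΦ' (t₀ - h) ⟨by linarith, by linarith [ht₀.2]⟩ t₀ ht₀
    have e2 := (abs_le.1 (hwL (t₀ - h) ⟨by linarith, by linarith [ht₀.2]⟩ t₀ ht₀)).1
    have e3 : |t₀ - h - t₀| = h := by rw [sub_sub_cancel_left, abs_neg, abs_of_pos hh0]
    have e4 : t₀ - h - t₀ + h = 0 := by ring
    rw [e3] at e2
    rw [e4] at e1
    nlinarith
  have hnd0 : 0 ≤ n * d ^ 2 := by positivity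
  have hdh : |d| < h := by
    by_contra! hge
    have e1 := (abs_le.1 (hwL s hs t ht)).2
    have e2 := hmax' t ht
    have e3 : |s - t| ≤ |d| + h := by
      have : s - t = d + -h := by rw [hd]; ring
      rw [this]
      refine (abs_add_le _ _).trans ?_
      rw [abs_neg, abs_of_pos hh0]
    have e4 : L * |s - t| ≤ L * (|d| + h) := by gcongr
    have e5 : n * d ^ 2 ≤ 3 * L * |d| := by
      have : L * h ≤ L * |d| := by gcongr
      linarith
    have e6 : 4 * L * |d| ≤ n * d ^ 2 := by
      rw [← sq_abs, sq, ← mul_assoc, ← hnh]; gcongr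
    have e7 : 0 < L * |d| := mul_pos hL (hh0.trans_le hge)
    linarith
  obtain ⟨hd1, hd2⟩ := abs_lt.1 hdh
  have hst : |s - t| < 2 * h := by rw [abs_lt]; constructor <;> linarith
  have hs0 : 0 < s := by
    refine lt_of_le_of_ne hs.1 fun hs00 => ?_
    have e1 := hvmod 0 (by simp) t ht (by
      rw [Real.dist_eq, hs00]; linarith)
    rw [Real.dist_eq] at e1
    have e2 := (abs_lt.1 e1).2
    rw [← hs00] at hlow
    linarith
  have hp : |2 * (n * d)| ≤ 8 * L := by
    rw [abs_mul, abs_mul, abs_two, abs_of_pos hn0]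
    have : n * |d| ≤ n * h := by gcongr
    linarith
  -- the two test functions have the same slope
  have hsub : lam * w s + H s (2 * (n * d)) ≤ 0 := by
    have hder : HasDerivAt (fun x => n * (x - t + h) ^ 2 + (w s - n * d ^ 2)) (2 * (n * d)) s := by
      have := (((((hasDerivAt_id s).sub_const t).add_const h).pow 2).const_mul n).add_const
        (w s - n * d ^ 2)
      refine HasDerivAt.congr_deriv this ?_
      simp only [id, hd]; ring
    have := hw.2 s ⟨hs0, by linarith [ht.2]⟩ (fun x => n * (x - t + h) ^ 2 + (w s - n * d ^ 2))
      ⟨by fun_prop, by simp only [← hd]; ring, 1, one_pos, fun x _ hx => by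
        linarith [hΦ' x hx t ht]⟩
    rw [hder.deriv] at this
    have e : n * (s - t + h) ^ 2 + (w s - n * d ^ 2) = w s := by rw [← hd]; ring
    rwa [e] at this
  have hder : HasDerivAt (fun x => -(n * (s - x + h) ^ 2) + (v t + n * d ^ 2)) (2 * (n * d)) t := by
    have := ((((((hasDerivAt_id t).const_sub s).add_const h).pow 2).const_mul n).neg).add_const
      (v t + n * d ^ 2)
    refine HasDerivAt.congr_deriv this ?_
    simp only [id, hd]; ring
  have hC1 : ContDiff ℝ 1 fun x => -(n * (s - x + h) ^ 2) + (v t + n * d ^ 2) := by fun_prop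
  have hvt : -(n * (s - t + h) ^ 2) + (v t + n * d ^ 2) = v t := by rw [← hd]; ring
  have hbelow : ∀ x ∈ Icc (0 : ℝ) 1, -(n * (s - x + h) ^ 2) + (v t + n * d ^ 2) ≤ v x :=
    fun x hx => by linarith [hΦ' s hs x hx]
  have hsup : 0 ≤ lam * v t + H t (2 * (n * d)) := by
    rcases ht.2.lt_or_eq with ht1 | rfl
    · have := hv.2 t ⟨by linarith, ht1⟩ _ ⟨hC1, hvt.symm, 1, one_pos, fun x _ hx => hbelow x hx⟩
      rw [hder.deriv] at this
      simpa only [hvt] using this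
    · rcases h1 with h1 | h1
      · exfalso
        have e1 := (abs_le.1 (hwL s hs 1 (by simp))).2
        have e2 : L * |s - 1| ≤ L * (2 * h) := by gcongr
        linarith
      · have := h1 _ ⟨hC1, hvt.symm, 1, one_pos, fun x _ hx => hbelow x hx⟩
        rw [hder.deriv] at this
        simpa only [hvt] using this
  have hdiff := (abs_lt.1 (hHmod s hs t ht _ _ hp hp (hst.trans hhδ₂) (by simpa using hδ₂))).1
  have : lam * (M * (3 / 4)) ≤ lam * (w s - v t) :=
    mul_le_mul_of_nonneg_left (by linarith) hlam.le
  nlinarith [mul_pos hlam hM0]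

end Arc

/-! ### The functional on paths -/

/-- The standing assumptions: positive discount factor, and continuous coercive Hamiltonians. -/
structure IsDiscountedFamily {E : Type*} (lam : ℝ) (H : E → ℝ → ℝ → ℝ) : Prop where
  pos : 0 < lam
  cont : ∀ e, IsContinuousHamiltonian (H e)
  coer : ∀ e, IsCoerciveHamiltonian (H e)

section Rho

variable {E : Type*} {lam : ℝ} {H : E → ℝ → ℝ → ℝ}

lemma IsDiscountedFamily.isLUB_rho (h : IsDiscountedFamily lam H) (e : E) (α : ℝ) :
    IsLUB (rhoSet lam (H e) α) (rho lam H α e) := by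
  obtain ⟨C, hC⟩ := exists_upper_bound h.pos (h.cont e) (h.coer e)
  obtain ⟨m₀, hm₀⟩ := exists_const_subsolution h.pos (h.cont e)
  refine isLUB_csSup ⟨min m₀ α, fun _ => min m₀ α, hm₀ _ (min_le_left _ _), min_le_right _ _, rfl⟩
    ⟨C, ?_⟩
  rintro _ ⟨w, hw, -, rfl⟩
  exact hC w hw 1 (by simp)

lemma IsDiscountedFamily.le_rho (h : IsDiscountedFamily lam H) {e : E} {α : ℝ} {w : ℝ → ℝ}
    (hw : IsArcSubsolution lam (H e) w) (hα : w 0 ≤ α) : w 1 ≤ rho lam H α e :=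
  (h.isLUB_rho e α).1 ⟨w, hw, hα, rfl⟩

lemma IsDiscountedFamily.exists_eq_rho (h : IsDiscountedFamily lam H) (e : E) (α : ℝ) :
    ∃ w, IsArcSubsolution lam (H e) w ∧ w 0 ≤ α ∧ w 1 = rho lam H α e := by
  obtain ⟨C, hC⟩ := exists_upper_bound h.pos (h.cont e) (h.coer e)
  obtain ⟨W, hW⟩ := exists_isMaximalSubsolution h.pos (h.cont e) (h.coer e) α C
  refine ⟨W, hW.1, hW.2.1, le_antisymm (h.le_rho hW.1 hW.2.1) ((h.isLUB_rho e α).2 ?_)⟩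
  rintro _ ⟨w, hw, hα, rfl⟩
  exact hW.2.2.2 w hw hα (hC w hw 1 (by simp)) 1 (by simp)

lemma IsDiscountedFamily.rho_mono (h : IsDiscountedFamily lam H) (e : E) :
    Monotone fun α => rho lam H α e := by
  intro α α' hα
  obtain ⟨w, hw, hw0, hw1⟩ := h.exists_eq_rho e α
  exact hw1.symm.trans_le (h.le_rho hw (hw0.trans hα))

/-- `ρ(·, e)` is strictly nonexpansive: lowering a subsolution by a positive constant makes it
strict, which leaves room for a small increase of its slope. -/
lemma IsDiscountedFamily.rho_sub_lt (h : IsDiscountedFamily lam H) (e : E) {α α' : ℝ}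
    (hα : α < α') : rho lam H α' e - rho lam H α e < α' - α := by
  obtain ⟨w, hw, hw0, hw1⟩ := h.exists_eq_rho e α'
  obtain ⟨R, hR, hmom, -⟩ := hw.exists_lipschitz h.pos (h.coer e)
  set c := α' - α with hc
  have hc0 : 0 < c := sub_pos.2 hα
  have hlc : 0 < lam * c := mul_pos h.pos hc0
  obtain ⟨δ, hδ, hmod⟩ := (h.cont e).uniform (R + 1) (η := lam * c / 2) (by linarith)
  obtain ⟨ε, hε, hε1, hεδ, hεc⟩ : ∃ ε > 0, ε ≤ 1 ∧ ε < δ ∧ ε ≤ c / 2 :=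
    ⟨min (min 1 (δ / 2)) (c / 2), lt_min (lt_min one_pos (by linarith)) (by linarith),
      (min_le_left _ _).trans (min_le_left _ _),
      ((min_le_left _ _).trans (min_le_right _ _)).trans_lt (by linarith), min_le_right _ _⟩
  have hsub : IsArcSubsolution lam (H e) fun s => w s - c + ε * s := by
    refine ⟨(hw.1.sub continuousOn_const).add (by fun_prop), ?_⟩
    rintro s hs φ ⟨hφ, h0, δ', hδ', hle⟩
    have hs' := Ioo_subset_Icc_self hs
    have hd : HasDerivAt (fun r => φ r + (c - ε * r)) (deriv φ s + -(ε * 1)) s :=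
      ((hφ.differentiable one_ne_zero) s).hasDerivAt.add
        (((hasDerivAt_id s).const_mul ε).const_sub c)
    have hws := hw.2 s hs (fun r => φ r + (c - ε * r)) ⟨hφ.add (by fun_prop), by
      simp only at h0 ⊢; linarith, δ', hδ', fun r hr hr' => by
        have := hle r hr hr'
        simp only at this ⊢
        linarith⟩
    rw [hd.deriv] at hws
    simp only at h0
    have hp := hmom s hs' _ (by
      have : w s = φ s + (c - ε * s) := by linarith
      rw [this]; exact hws)
    have hq : |deriv φ s| ≤ R + 1 := by
      have h1 := abs_le.1 hp
      rw [abs_le]; constructor <;> linarith [h1.1, h1.2]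
    have hH := (abs_lt.1 (hmod s hs' s hs' (deriv φ s) (deriv φ s + -(ε * 1)) hq
      (by linarith) (by simpa using hδ) (by
        rw [sub_add_cancel_left, neg_neg, mul_one, abs_of_pos hε]; exact hεδ))).2
    have h1 : lam * (ε * s) ≤ lam * (c / 2) := by
      have : ε * s ≤ ε * 1 := by gcongr; exact hs'.2
      exact mul_le_mul_of_nonneg_left (by linarith) h.pos.le
    linarith
  have := h.le_rho (α := α) hsub (by linarith)
  linarith

lemma rhoPath_cons (α : ℝ) (e : E) (ξ : List E) :
    rhoPath lam H α (e :: ξ) = rhoPath lam H (rho lam H α e) ξ := rfl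

lemma rhoPath_concat (α : ℝ) (ξ : List E) (e : E) :
    rhoPath lam H α (ξ ++ [e]) = rho lam H (rhoPath lam H α ξ) e := by
  simp [rhoPath]

lemma IsDiscountedFamily.rhoPath_mono (h : IsDiscountedFamily lam H) (ξ : List E) :
    Monotone fun α => rhoPath lam H α ξ := by
  induction ξ with
  | nil => exact monotone_id
  | cons e ξ ih => exact ih.comp (h.rho_mono e)

lemma IsDiscountedFamily.rhoPath_sub_le (h : IsDiscountedFamily lam H) (ξ : List E) {α α' : ℝ}
    (hα : α ≤ α') : rhoPath lam H α' ξ - rhoPath lam H α ξ ≤ α' - α := by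
  induction ξ generalizing α α' with
  | nil => exact le_rfl
  | cons e ξ ih =>
    refine (ih (h.rho_mono e hα)).trans ?_
    rcases hα.eq_or_lt with rfl | hlt
    · simp
    · exact (h.rho_sub_lt e hlt).le

lemma IsDiscountedFamily.rhoPath_sub_lt (h : IsDiscountedFamily lam H) {ξ : List E} (hξ : ξ ≠ [])
    {α α' : ℝ} (hα : α < α') : rhoPath lam H α' ξ - rhoPath lam H α ξ < α' - α := by
  cases ξ with
  | nil => exact absurd rfl hξ
  | cons e ξ => exact (h.rhoPath_sub_le ξ (h.rho_mono e hα.le)).trans_lt (h.rho_sub_lt e hα)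

lemma IsDiscountedFamily.continuous_rhoPath (h : IsDiscountedFamily lam H) (ξ : List E) :
    Continuous fun α => rhoPath lam H α ξ := by
  refine (LipschitzWith.of_le_add fun x y => ?_).continuous
  rcases le_total x y with hxy | hxy
  · exact (h.rhoPath_mono ξ hxy).trans (le_add_of_nonneg_right dist_nonneg)
  · rw [Real.dist_eq, abs_of_nonneg (sub_nonneg.2 hxy)]
    linarith [h.rhoPath_sub_le ξ hxy]

lemma IsDiscountedFamily.exists_le_rho [Finite E] (h : IsDiscountedFamily lam H) :
    ∃ α₀ : ℝ, ∀ e, α₀ ≤ rho lam H α₀ e := by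
  choose m hm using fun e => exists_const_subsolution h.pos (h.cont e)
  obtain ⟨α₀, hα₀⟩ := (finite_range m).bddBelow
  exact ⟨α₀, fun e => h.le_rho (hm e α₀ (hα₀ (mem_range_self e))) le_rfl⟩

lemma IsDiscountedFamily.exists_rho_le [Finite E] (h : IsDiscountedFamily lam H) :
    ∃ C : ℝ, ∀ e α, rho lam H α e ≤ C := by
  choose C hC using fun e => exists_upper_bound h.pos (h.cont e) (h.coer e)
  obtain ⟨B, hB⟩ := (finite_range C).bddAbove
  refine ⟨B, fun e α => ?_⟩
  obtain ⟨w, hw, -, hw1⟩ := h.exists_eq_rho e α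
  exact hw1 ▸ (hC e w hw 1 (by simp)).trans (hB (mem_range_self e))

lemma IsDiscountedFamily.le_rhoPath (h : IsDiscountedFamily lam H) {α₀ : ℝ}
    (h₀ : ∀ e, α₀ ≤ rho lam H α₀ e) (ξ : List E) : α₀ ≤ rhoPath lam H α₀ ξ := by
  induction ξ with
  | nil => exact le_rfl
  | cons e ξ ih => exact ih.trans (h.rhoPath_mono ξ (h₀ e))

lemma IsDiscountedFamily.existsUnique_fixedPoint [Finite E] (h : IsDiscountedFamily lam H)
    {ξ : List E} (hξ : ξ ≠ []) : ∃! α : ℝ, rhoPath lam H α ξ = α := by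
  obtain ⟨α₀, hα₀⟩ := h.exists_le_rho
  obtain ⟨C, hC⟩ := h.exists_rho_le
  have hle : ∀ α, rhoPath lam H α ξ ≤ C := by
    intro α
    obtain ⟨ξ', e, rfl⟩ := (List.eq_nil_or_concat' ξ).resolve_left hξ
    rw [rhoPath_concat]; exact hC e _
  have hivt := intermediate_value_Icc' (le_max_left α₀ C)
    ((h.continuous_rhoPath ξ).sub continuous_id).continuousOn
  obtain ⟨α, -, hα⟩ := hivt (show (0 : ℝ) ∈ _ from
    ⟨sub_nonpos.2 ((hle _).trans (le_max_right α₀ C)), sub_nonneg.2 (h.le_rhoPath hα₀ ξ)⟩)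
  have hα : rhoPath lam H α ξ = α := sub_eq_zero.1 hα
  refine ⟨α, hα, fun β (hβ : rhoPath lam H β ξ = β) => ?_⟩
  rcases lt_trichotomy α β with hlt | rfl | hlt
  · linarith [h.rhoPath_sub_lt hξ hlt]
  · rfl
  · linarith [h.rhoPath_sub_lt hξ hlt]

lemma IsDiscountedFamily.rhoPath_beta [Finite E] (h : IsDiscountedFamily lam H) {ξ : List E}
    (hξ : ξ ≠ []) : rhoPath lam H (beta lam H ξ) ξ = beta lam H ξ :=
  Classical.epsilon_spec (h.existsUnique_fixedPoint hξ).exists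

lemma IsDiscountedFamily.le_beta [Finite E] (h : IsDiscountedFamily lam H) {ξ : List E}
    (hξ : ξ ≠ []) {α : ℝ} (hα : α ≤ rhoPath lam H α ξ) : α ≤ beta lam H ξ := by
  by_contra! hlt
  linarith [h.rhoPath_sub_lt hξ hlt, h.rhoPath_beta hξ]

end Rho

namespace Network

variable {N : ℕ} {E : Type*} (G : Network N E) {lam : ℝ} {H : E → ℝ → ℝ → ℝ}

/-! ### Paths and the discrete equation on vertices -/

lemma orig_rev (e : E) : G.orig (G.rev e) = G.term e := by
  simpa [orig, term] using G.arc_rev e 0 (by simp)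

lemma term_rev (e : E) : G.term (G.rev e) = G.orig e := by
  simpa [orig, term] using G.arc_rev e 1 (by simp)

variable {G}

lemma exists_term_eq {x : EuclideanSpace ℝ (Fin N)} (hx : x ∈ G.vertices) : ∃ e, G.term e = x := by
  obtain ⟨e, he | he⟩ := hx
  · exact ⟨G.rev e, by rw [term_rev, he]⟩
  · exact ⟨e, he⟩

lemma term_mem_vertices (e : E) : G.term e ∈ G.vertices := ⟨e, Or.inr rfl⟩

lemma orig_mem_vertices (e : E) : G.orig e ∈ G.vertices := ⟨e, Or.inl rfl⟩

lemma IsPath.ne_nil {x y : EuclideanSpace ℝ (Fin N)} {ξ : List E} (h : G.IsPath x ξ y) :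
    ξ ≠ [] := by
  cases h <;> simp

lemma IsPath.orig_mem {x y : EuclideanSpace ℝ (Fin N)} {ξ : List E} (h : G.IsPath x ξ y) :
    x ∈ G.vertices := by
  cases h <;> exact orig_mem_vertices _

lemma IsPath.concat {x y : EuclideanSpace ℝ (Fin N)} {ξ : List E} (h : G.IsPath x ξ y) {e : E}
    (he : G.orig e = y) : G.IsPath x (ξ ++ [e]) (G.term e) := by
  induction h with
  | single a => exact .cons a (he ▸ .single e)
  | cons a _ ih => exact .cons a (ih he)

lemma IsPath.eq_single_or_concat {x y : EuclideanSpace ℝ (Fin N)} {ξ : List E}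
    (h : G.IsPath x ξ y) : ∃ e, G.term e = y ∧
      ((ξ = [e] ∧ x = G.orig e) ∨ ∃ ξ', ξ = ξ' ++ [e] ∧ G.IsPath x ξ' (G.orig e)) := by
  induction h with
  | single a => exact ⟨a, rfl, Or.inl ⟨rfl, rfl⟩⟩
  | cons a _ ih =>
    obtain ⟨e, he, ⟨rfl, hx⟩ | ⟨ξ', rfl, hξ'⟩⟩ := ih
    · exact ⟨e, he, Or.inr ⟨[a], rfl, hx ▸ .single a⟩⟩
    · exact ⟨e, he, Or.inr ⟨a :: ξ', rfl, .cons a hξ'⟩⟩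

lemma isGLB_f [Finite E] (h : IsDiscountedFamily lam H) {x : EuclideanSpace ℝ (Fin N)}
    (hx : x ∈ G.vertices) : IsGLB (G.fSet lam H x) (G.f lam H x) := by
  obtain ⟨α₀, hα₀⟩ := h.exists_le_rho
  obtain ⟨e, rfl⟩ := exists_term_eq hx
  refine isGLB_csInf ⟨_, [G.rev e, e], ?_, rfl⟩ ⟨α₀, ?_⟩
  · have h1 : G.IsPath (G.orig (G.rev e)) [G.rev e, e] (G.term e) :=
      .cons _ (by rw [term_rev]; exact .single e)
    rwa [orig_rev] at h1
  · rintro _ ⟨ξ, hξ, rfl⟩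
    exact h.le_beta hξ.ne_nil (h.le_rhoPath hα₀ ξ)

lemma isGLB_U [Finite E] (h : IsDiscountedFamily lam H) {x : EuclideanSpace ℝ (Fin N)}
    (hx : x ∈ G.vertices) : IsGLB (G.USet lam H x) (G.U lam H x) := by
  obtain ⟨α₀, hα₀⟩ := h.exists_le_rho
  obtain ⟨e, rfl⟩ := exists_term_eq hx
  refine isGLB_csInf ⟨_, _, [e], .single e, rfl⟩ ⟨α₀, ?_⟩
  rintro _ ⟨y, ξ, hξ, rfl⟩
  have hf : α₀ ≤ G.f lam H y := by
    refine (isGLB_f h hξ.orig_mem).2 ?_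
    rintro _ ⟨ζ, hζ, rfl⟩
    exact h.le_beta hζ.ne_nil (h.le_rhoPath hα₀ ζ)
  exact (h.le_rhoPath hα₀ ξ).trans (h.rhoPath_mono ξ hf)

/-- The discrete counterpart of the problem: `g x` is the minimum of `ρ(g(o(e)), e)` over the edges
`e` ending at the vertex `x`. -/
def IsDiscreteSolution (G : Network N E) (lam : ℝ) (H : E → ℝ → ℝ → ℝ)
    (g : EuclideanSpace ℝ (Fin N) → ℝ) : Prop :=
  (∀ e, g (G.term e) ≤ rho lam H (g (G.orig e)) e) ∧
    ∀ x ∈ G.vertices, ∃ e, G.term e = x ∧ g x = rho lam H (g (G.orig e)) e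

lemma IsDiscreteSolution.le_rhoPath (h : IsDiscountedFamily lam H)
    {g : EuclideanSpace ℝ (Fin N) → ℝ} (hg : G.IsDiscreteSolution lam H g)
    {x y : EuclideanSpace ℝ (Fin N)} {ξ : List E} (hξ : G.IsPath x ξ y) :
    g y ≤ rhoPath lam H (g x) ξ := by
  induction hξ with
  | single e => exact hg.1 e
  | cons e hξ ih => exact ih.trans (h.rhoPath_mono _ (hg.1 e))

/-- Following optimal edges backwards from `x` eventually closes a cycle, on which `g` is the fixed
point `β`; hence `g` is given by the representation formula. -/
theorem IsDiscreteSolution.eq_U [Finite E] (h : IsDiscountedFamily lam H)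
    {g : EuclideanSpace ℝ (Fin N) → ℝ} (hg : G.IsDiscreteSolution lam H g)
    {x : EuclideanSpace ℝ (Fin N)} (hx : x ∈ G.vertices) : g x = G.U lam H x := by
  have hf : ∀ y ∈ G.vertices, g y ≤ G.f lam H y := by
    intro y hy
    refine (isGLB_f h hy).2 ?_
    rintro _ ⟨ξ, hξ, rfl⟩
    exact h.le_beta hξ.ne_nil (hg.le_rhoPath h hξ)
  refine le_antisymm ((isGLB_U h hx).2 ?_) ?_
  · rintro _ ⟨y, ξ, hξ, rfl⟩
    exact (hg.le_rhoPath h hξ).trans (h.rhoPath_mono ξ (hf y hξ.orig_mem))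
  choose next hterm hval using fun e => hg.2 (G.orig e) (orig_mem_vertices e)
  obtain ⟨e₀, he₀, hv₀⟩ := hg.2 x hx
  set s : ℕ → E := fun n => next^[n] e₀ with hs
  have hs1 : ∀ n, s (n + 1) = next (s n) := fun n => Function.iterate_succ_apply' next n e₀
  have hopt : ∀ n, g (G.term (s n)) = rho lam H (g (G.orig (s n))) (s n) := by
    intro n
    cases n with
    | zero => rw [show s 0 = e₀ from rfl, he₀]; exact hv₀
    | succ n => rw [hs1, hterm]; exact hval (s n)
  have hpath : ∀ m k, ∃ ξ, G.IsPath (G.orig (s (m + k))) ξ (G.term (s m)) ∧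
      rhoPath lam H (g (G.orig (s (m + k)))) ξ = g (G.term (s m)) := by
    intro m k
    induction k with
    | zero => exact ⟨[s m], .single _, (hopt m).symm⟩
    | succ k ih =>
      obtain ⟨ξ, hξ, hval'⟩ := ih
      have ht : G.term (s (m + (k + 1))) = G.orig (s (m + k)) := by
        rw [← add_assoc, hs1, hterm]
      refine ⟨s (m + (k + 1)) :: ξ, .cons _ (by rwa [ht]), ?_⟩
      rw [rhoPath_cons, ← hopt, ht, hval']
  obtain ⟨m, n, hmn, heq⟩ : ∃ m n, m < n ∧ s m = s n := by
    obtain ⟨m, n, hne, heq⟩ := Finite.exists_ne_map_eq_of_infinite s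
    rcases hne.lt_or_gt with hlt | hlt
    · exact ⟨m, n, hlt, heq⟩
    · exact ⟨n, m, hlt, heq.symm⟩
  obtain ⟨k, rfl⟩ : ∃ k, n = m + k + 1 := ⟨n - m - 1, by omega⟩
  have hz : G.orig (s (m + k)) = G.term (s m) := by rw [heq, hs1, hterm]
  obtain ⟨ξ, hξ, hξv⟩ := hpath m k
  obtain ⟨ζ, hζ, hζv⟩ := hpath 0 (m + k)
  rw [zero_add, show s 0 = e₀ from rfl, he₀] at hζ hζv
  rw [hz] at hξ hξv hζ hζv
  have hbeta : beta lam H ξ = g (G.term (s m)) :=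
    (h.existsUnique_fixedPoint hξ.ne_nil).unique (h.rhoPath_beta hξ.ne_nil) hξv
  have hfz : G.f lam H (G.term (s m)) ≤ g (G.term (s m)) :=
    (isGLB_f h (term_mem_vertices _)).1 ⟨ξ, hξ, hbeta⟩
  calc G.U lam H x ≤ rhoPath lam H (G.f lam H (G.term (s m))) ζ :=
        (isGLB_U h hx).1 ⟨_, ζ, hζ, rfl⟩
    _ ≤ rhoPath lam H (g (G.term (s m))) ζ := h.rhoPath_mono ζ hfz
    _ = g x := hζv

/-- Splitting off the last edge of a path, and using `U ≤ f`, turns the infimum over paths ending at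
`x` into a minimum over the finitely many edges ending at `x`. -/
theorem isDiscreteSolution_U [Finite E] (h : IsDiscountedFamily lam H) :
    G.IsDiscreteSolution lam H (G.U lam H) := by
  have hle : ∀ e, G.U lam H (G.term e) ≤ rho lam H (G.U lam H (G.orig e)) e := by
    intro e
    have hglb := isGLB_U (lam := lam) (H := H) h (orig_mem_vertices (G := G) e)
    refine le_of_forall_pos_le_add fun ε hε => ?_
    obtain ⟨_, ⟨y, ξ, hξ, rfl⟩, hr, hr'⟩ :=
      hglb.exists_between (lt_add_of_pos_right (G.U lam H (G.orig e)) hε)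
    have h1 : G.U lam H (G.term e) ≤ rhoPath lam H (G.f lam H y) (ξ ++ [e]) :=
      (isGLB_U h (term_mem_vertices e)).1 ⟨y, _, hξ.concat rfl, rfl⟩
    rw [rhoPath_concat] at h1
    have h2 := h.rhoPath_sub_le [e] hr
    simp only [rhoPath_cons] at h2
    change rho lam H (rhoPath lam H (G.f lam H y) ξ) e - rho lam H (G.U lam H (G.orig e)) e ≤ _
      at h2
    linarith
  refine ⟨hle, fun x hx => ?_⟩
  have hUf : ∀ y ∈ G.vertices, G.U lam H y ≤ G.f lam H y := by
    intro y hy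
    refine (isGLB_f h hy).2 ?_
    rintro _ ⟨ξ, hξ, rfl⟩
    rw [← h.rhoPath_beta hξ.ne_nil]
    exact ((isGLB_U h hy).1 ⟨y, ξ, hξ, rfl⟩).trans
      (h.rhoPath_mono ξ ((isGLB_f h hy).1 ⟨ξ, hξ, rfl⟩))
  obtain ⟨e, he, hmin⟩ := exists_min_image {e | G.term e = x}
    (fun e => rho lam H (G.U lam H (G.orig e)) e) (toFinite _) (exists_term_eq hx)
  refine ⟨e, he, le_antisymm (he ▸ hle e) ((isGLB_U h hx).2 ?_)⟩
  rintro _ ⟨y, ξ, hξ, rfl⟩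
  obtain ⟨a, ha, ⟨rfl, rfl⟩ | ⟨ξ', rfl, hξ'⟩⟩ := hξ.eq_single_or_concat
  · exact (hmin a ha).trans (h.rho_mono a (hUf _ (orig_mem_vertices a)))
  · rw [rhoPath_concat]
    exact (hmin a ha).trans
      (h.rho_mono a ((isGLB_U h (orig_mem_vertices a)).1 ⟨y, ξ', hξ', rfl⟩))

/-! ### Reduction of the network problem to the vertices -/

lemma pull_eq (u : G.carrier → ℝ) (e : E) (s : Icc (0 : ℝ) 1) :
    G.pull u e s = u (G.point e s) := IccExtend_val _ _ s

lemma isArcSubsolution_of_rev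
    (hrev : ∀ e, ∀ s ∈ Icc (0 : ℝ) 1, ∀ p : ℝ, H (G.rev e) s p = H e (1 - s) (-p)) {e : E}
    {w : ℝ → ℝ} (hw : IsArcSubsolution lam (H (G.rev e)) w) :
    IsArcSubsolution lam (H e) fun s => w (1 - s) :=
  hw.reflect.congr_hamiltonian fun s hs p => by
    rw [hrev e (1 - s) ⟨by linarith [hs.2], by linarith [hs.1]⟩, sub_sub_cancel, neg_neg]

lemma isArcSubsolution_rev
    (hrev : ∀ e, ∀ s ∈ Icc (0 : ℝ) 1, ∀ p : ℝ, H (G.rev e) s p = H e (1 - s) (-p)) {e : E}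
    {w : ℝ → ℝ} (hw : IsArcSubsolution lam (H e) w) :
    IsArcSubsolution lam (H (G.rev e)) fun s => w (1 - s) :=
  isArcSubsolution_of_rev hrev (by rwa [G.rev_rev])

lemma isMaximalSubsolution_rev
    (hrev : ∀ e, ∀ s ∈ Icc (0 : ℝ) 1, ∀ p : ℝ, H (G.rev e) s p = H e (1 - s) (-p)) {e : E}
    {a b : ℝ} {W : ℝ → ℝ} (hW : IsMaximalSubsolution lam (H e) a b W) :
    IsMaximalSubsolution lam (H (G.rev e)) b a fun s => W (1 - s) := by
  refine ⟨isArcSubsolution_rev hrev hW.1, by simpa using hW.2.2.1, by simpa using hW.2.1,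
    fun w hw h0 h1 s hs => ?_⟩
  have := hW.2.2.2 _ (isArcSubsolution_of_rev hrev hw) (by simpa using h1) (by simpa using h0)
    (1 - s) ⟨by linarith [hs.2], by linarith [hs.1]⟩
  simpa using this

/-- The trace of a solution on the vertices solves the discrete equation: the inequality says that
`u` is a subsolution along every edge, and the equality follows by comparison along an edge on
which the state constraint holds. -/
theorem IsSolution.eq_U [Finite E] (h : IsDiscountedFamily lam H) {u : G.carrier → ℝ}
    (hu : G.IsSolution lam H u) (x : G.carrier)
    (hx : (x : EuclideanSpace ℝ (Fin N)) ∈ G.vertices) : u x = G.U lam H x := by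
  classical
  set g : EuclideanSpace ℝ (Fin N) → ℝ := fun x => if hx : x ∈ G.carrier then u ⟨x, hx⟩ else 0
    with hg
  have hgx : ∀ x : G.carrier, g x = u x := fun x => by simp [hg]
  have hg0 : ∀ e, g (G.orig e) = G.pull u e 0 := fun e =>
    (hgx (G.point e ⟨0, by simp⟩)).trans (pull_eq u e ⟨0, by simp⟩).symm
  have hg1 : ∀ e, g (G.term e) = G.pull u e 1 := fun e =>
    (hgx (G.point e ⟨1, by simp⟩)).trans (pull_eq u e ⟨1, by simp⟩).symm
  have hle : ∀ e, g (G.term e) ≤ rho lam H (g (G.orig e)) e := fun e =>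
    (hg1 e).trans_le (h.le_rho (hu.1.2 e) (hg0 e).ge)
  have hd : G.IsDiscreteSolution lam H g := by
    refine ⟨hle, fun x hx => ?_⟩
    obtain ⟨e, rfl, hsc⟩ := hu.2.2.2 x hx
    refine ⟨e, rfl, le_antisymm (hle e) ?_⟩
    obtain ⟨w, hw, hw0, hw1⟩ := h.exists_eq_rho e (g (G.orig e))
    rw [← hw1, hg1]
    exact hw.le_of_isArcSupersolution h.pos (h.cont e) (h.coer e) (hu.2.2.1 e)
      (hw0.trans (hg0 e).le) (Or.inr hsc) 1 (by simp)
  rw [← hgx, hd.eq_U h hx]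

lemma IsSolution.pull_le [Finite E] (h : IsDiscountedFamily lam H) {u v : G.carrier → ℝ}
    (hu : G.IsSolution lam H u) (hv : G.IsSolution lam H v) (e : E) (s : Icc (0 : ℝ) 1) :
    u (G.point e s) ≤ v (G.point e s) := by
  have key : ∀ s : Icc (0 : ℝ) 1, (G.point e s : EuclideanSpace ℝ (Fin N)) ∈ G.vertices →
      G.pull u e s ≤ G.pull v e s := fun s hs => by
    rw [pull_eq, pull_eq, hu.eq_U h _ hs, hv.eq_U h _ hs]
  rw [← pull_eq u, ← pull_eq v]
  exact (hu.1.2 e).le_of_isArcSupersolution h.pos (h.cont e) (h.coer e) (hv.2.2.1 e)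
    (key ⟨0, by simp⟩ (orig_mem_vertices e)) (Or.inl (key ⟨1, by simp⟩ (term_mem_vertices e))) s s.2

theorem IsSolution.unique [Finite E] (h : IsDiscountedFamily lam H) {u v : G.carrier → ℝ}
    (hu : G.IsSolution lam H u) (hv : G.IsSolution lam H v) : v = u := by
  funext ⟨x, hx⟩
  obtain ⟨e, s, hs, rfl⟩ := mem_iUnion.1 hx
  exact le_antisymm (hv.pull_le h hu e ⟨s, hs⟩) (hu.pull_le h hv e ⟨s, hs⟩)

lemma continuous_point (e : E) : Continuous (G.point e) :=
  ((G.contDiffOn_arc e).continuousOn.comp_continuous continuous_subtype_val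
    fun s => s.2).subtype_mk _

/-- The network carries the quotient topology of the disjoint union of its parametrizations. -/
lemma continuous_of_forall_point [Finite E] {u : G.carrier → ℝ}
    (hu : ∀ e, Continuous fun s => u (G.point e s)) : Continuous u := by
  set π : (Σ _ : E, Icc (0 : ℝ) 1) → G.carrier := fun q => G.point q.1 q.2 with hπ
  have hc : Continuous π := continuous_sigma fun e => continuous_point e
  have hsurj : Function.Surjective π := by
    rintro ⟨x, hx⟩
    obtain ⟨e, s, hs, rfl⟩ := mem_iUnion.1 hx
    exact ⟨⟨e, s, hs⟩, rfl⟩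
  exact (hc.isClosedMap.isQuotientMap hc hsurj).continuous_iff.2 (continuous_sigma hu)

/-- Functions on the arcs compatible with reversal of orientation and with given vertex values take
the same value wherever two parametrizations meet. -/
lemma eq_of_arc_eq {W : E → ℝ → ℝ} {g : EuclideanSpace ℝ (Fin N) → ℝ}
    (hW0 : ∀ e, W e 0 = g (G.orig e)) (hW1 : ∀ e, W e 1 = g (G.term e))
    (hWrev : ∀ e, ∀ s ∈ Icc (0 : ℝ) 1, W (G.rev e) s = W e (1 - s)) {e e' : E} {s t : ℝ}
    (hs : s ∈ Icc (0 : ℝ) 1) (ht : t ∈ Icc (0 : ℝ) 1) (heq : G.arc e s = G.arc e' t) :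
    W e s = W e' t := by
  have same : ∀ e, ∀ s ∈ Icc (0 : ℝ) 1, ∀ t ∈ Icc (0 : ℝ) 1, G.arc e s = G.arc e t →
      W e s = W e t := by
    have hlt : ∀ e, ∀ s ∈ Icc (0 : ℝ) 1, ∀ t ∈ Icc (0 : ℝ) 1, s < t → G.arc e s = G.arc e t →
        W e s = W e t := by
      intro e s hs t ht hst heq
      obtain ⟨rfl, rfl⟩ := G.simple_arc e s hs t ht hst heq
      rw [hW0, hW1]
      exact congrArg g heq
    intro e s hs t ht heq
    rcases lt_trichotomy s t with h | rfl | h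
    · exact hlt e s hs t ht h heq
    · rfl
    · exact (hlt e t ht s hs h heq.symm).symm
  have hend : ∀ e, ∀ s ∈ Icc (0 : ℝ) 1, s ∉ Ioo (0 : ℝ) 1 → W e s = g (G.arc e s) := by
    intro e s hs hs'
    rcases hs.1.eq_or_lt with rfl | h0
    · exact hW0 e
    · rcases hs.2.eq_or_lt with rfl | h1
      · exact hW1 e
      · exact absurd ⟨h0, h1⟩ hs'
  by_cases h1 : e' = e
  · subst h1; exact same _ s hs t ht heq
  by_cases h2 : e' = G.rev e
  · subst h2
    rw [hWrev e t ht]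
    rw [G.arc_rev e t ht] at heq
    exact same e s hs _ ⟨by linarith [ht.2], by linarith [ht.1]⟩ heq
  have h3 : e ≠ G.rev e' := fun h => h2 (by rw [h, G.rev_rev])
  rw [hend e s hs fun hs' => G.arc_disjoint e e' h1 h2 s hs' t ht heq,
    hend e' t ht fun ht' => G.arc_disjoint e' e (Ne.symm h1) h3 t ht' s hs heq.symm, heq]

/-- A solution is obtained by gluing the maximal subsolutions on the arcs with boundary values `U`.
-/
theorem exists_isSolution [Finite E] (h : IsDiscountedFamily lam H)
    (hrev : ∀ e, ∀ s ∈ Icc (0 : ℝ) 1, ∀ p : ℝ, H (G.rev e) s p = H e (1 - s) (-p)) :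
    ∃ u : G.carrier → ℝ, G.IsSolution lam H u := by
  have hU : G.IsDiscreteSolution lam H (G.U lam H) := isDiscreteSolution_U h
  choose W hW using fun e => exists_isMaximalSubsolution h.pos (h.cont e) (h.coer e)
    (G.U lam H (G.orig e)) (G.U lam H (G.term e))
  -- The bound at `0` is attained by a subsolution for the reversed edge.
  have hbd : ∀ e, W e 0 = G.U lam H (G.orig e) ∧ W e 1 = G.U lam H (G.term e) := by
    intro e
    obtain ⟨w, hw, hw0, hw1⟩ := h.exists_eq_rho e (G.U lam H (G.orig e))
    obtain ⟨v, hv, hv0, hv1⟩ := h.exists_eq_rho (G.rev e) (G.U lam H (G.term e))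
    have hle := hU.1 (G.rev e)
    rw [term_rev, orig_rev, ← hv1] at hle
    exact (hW e).boundary_eq h.pos hw hw0 (hw1 ▸ hU.1 e) (isArcSubsolution_of_rev hrev hv)
      (by simpa using hle) (by simpa using hv0)
  have hWrev : ∀ e, ∀ s ∈ Icc (0 : ℝ) 1, W (G.rev e) s = W e (1 - s) := by
    intro e s hs
    have h1 := hW (G.rev e)
    rw [term_rev, orig_rev] at h1
    exact h1.eqOn (isMaximalSubsolution_rev hrev (hW e)) hs
  have hex : ∀ x : G.carrier, ∃ e, ∃ s : Icc (0 : ℝ) 1, G.point e s = x := by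
    rintro ⟨x, hx⟩
    obtain ⟨e, s, hs, rfl⟩ := mem_iUnion.1 hx
    exact ⟨e, ⟨s, hs⟩, rfl⟩
  choose edge param hparam using hex
  set u : G.carrier → ℝ := fun x => W (edge x) (param x) with hu
  have hpt : ∀ e s, u (G.point e s) = W e s := fun e s =>
    eq_of_arc_eq (fun e => (hbd e).1) (fun e => (hbd e).2) hWrev (param _).2 s.2
      (congrArg Subtype.val (hparam (G.point e s)))
  have hpull : ∀ e, EqOn (G.pull u e) (W e) (Icc 0 1) := fun e s hs =>
    (pull_eq u e ⟨s, hs⟩).trans (hpt e ⟨s, hs⟩)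
  have hcont : Continuous u := continuous_of_forall_point fun e => by
    simp only [hpt]
    exact (hW e).1.1.domRestrict
  refine ⟨u, ⟨hcont, fun e => (hW e).1.congr (hpull e)⟩, hcont,
    fun e => ((hW e).isArcSupersolution (h.cont e)).congr (hpull e), fun x hx => ?_⟩
  -- On an edge realizing the minimum, the bound `U` at the endpoint `1` is not active.
  obtain ⟨e, rfl, he⟩ := hU.2 x hx
  refine ⟨e, rfl, ((hW e).stateConstraintAtOne (h.cont e) fun w hw hw0 => ?_).congr (hpull e)⟩
  rw [(hbd e).2, he]
  exact h.le_rho hw hw0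

end Network

end HJNetwork

theorem mainTheorem1 {N : ℕ} {E : Type*} [Finite E] (G : HJNetwork.Network N E)
    (lam : ℝ) (hlam : 0 < lam) (H : E → ℝ → ℝ → ℝ)
    (hcont : ∀ e, HJNetwork.IsContinuousHamiltonian (H e))
    (hcoer : ∀ e, HJNetwork.IsCoerciveHamiltonian (H e))
    (hrev : ∀ e, ∀ s ∈ Set.Icc (0 : ℝ) 1, ∀ p : ℝ, H (G.rev e) s p = H e (1 - s) (-p)) :
    (∃ u : G.carrier → ℝ, G.IsSolution lam H u ∧
      (∀ v : G.carrier → ℝ, G.IsSolution lam H v → v = u) ∧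
      ∀ x : G.carrier, (x : EuclideanSpace ℝ (Fin N)) ∈ G.vertices → u x = G.U lam H x) ∧
    -- the quantities in the representation formula are well defined
    (∀ e α, IsLUB (HJNetwork.rhoSet lam (H e) α) (HJNetwork.rho lam H α e)) ∧
    (∀ x ξ, G.IsPath x ξ x → ∃! α : ℝ, HJNetwork.rhoPath lam H α ξ = α) ∧
    (∀ x ∈ G.vertices, IsGLB (G.fSet lam H x) (G.f lam H x)) ∧
    (∀ x ∈ G.vertices, IsGLB (G.USet lam H x) (G.U lam H x)) := by
  have h : HJNetwork.IsDiscountedFamily lam H := ⟨hlam, hcont, hcoer⟩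
  obtain ⟨u, hu⟩ := HJNetwork.Network.exists_isSolution h hrev
  exact ⟨⟨u, hu, fun v hv => hu.unique h hv, fun x hx => hu.eq_U h x hx⟩, h.isLUB_rho,
    fun x ξ hξ => h.existsUnique_fixedPoint hξ.ne_nil,
    fun x hx => HJNetwork.Network.isGLB_f h hx, fun x hx => HJNetwork.Network.isGLB_U h hx⟩
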